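/- Let $p\in(0,1]$ and let $X$, $\xi$ be real random variables with $\mathbb P(X=0)<1$, $\mathbb P(\xi=0)<1$, $\xi\ge 0$ almost surely, and $X,\xi\in L^\alpha(\mathbb P)$ for some $\alpha>1$. Write $m_1=\mathbb E\,\xi$, and $0\log 0=0$. Let $(X_n)_{n\ge1}$, $(\varepsilon_n)_{n\ge2}$, $(\mathcal U[n])_{n\ge2}$, $(\xi_n)_{n\ge2}$ be mutually independent random variables such that each $X_n$ is distributed as $X$, each $\varepsilon_n$ is Bernoulli$(p)$, $\mathcal U[n]$ is uniform on $\{1,\dots,n-1\}$ and each $\xi_n$ is distributed as $\xi$. The random walk with echoed steps is $\tilde S_n=\tilde X_1+\cdots+\tilde X_n$, $n\ge 1$, where $$\tilde X_1=X_1,\qquad \tilde X_n=(1-\varepsilon_n)X_n+\varepsilon_n\,\xi_n\,\tilde X_{\mathcal U[n]}\quad(n\ge2).$$ **Theorem 2.** If $pm_1\le1$, there exists $\gamma>1$, depending only on $p$ and the laws of $X$ and $\xi$, such that: i) If $pm_1=1$ and $\mathbb E[\xi\log\xi]<m_1$, then $$\lim_{n\to\infty}\frac{\tilde S_n}{n\log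 n}=(1-p)\,\mathbb E X\quad\text{a.s. and in }L^\gamma(\mathbb P).$$ ii) If $pm_1<1$, then $$\lim_{n\to\infty}\frac{\tilde S_n}{n}=\frac{(1-p)\,\mathbb E X}{1-pm_1}\quad\text{a.s. and in }L^\gamma(\mathbb P).$$ -/

import Mathlib

open MeasureTheory ProbabilityTheory Filter Topology

/-- The increments of the random walk with echoed steps (times start at `1`). At time `1` the
increment is `X 1`; at time `n ≥ 2` it is
`(1 - ε n) * X n + ε n * ξ n * (increment at the remembered time U n)`.
The remembered time lies in `{1, …, n - 1}` almost surely; the value `0` in the inner `else` branch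
only serves to make the recursion total on the exceptional null set, and the index `0` is not
used by the model. -/
def echoStep {Ω : Type*} (X ε ξ : ℕ → Ω → ℝ) (U : ℕ → Ω → ℕ) (n : ℕ) (ω : Ω) : ℝ :=
  if n ≤ 1 then X n ω
  else (1 - ε n ω) * X n ω +
    ε n ω * ξ n ω *
      (if _h : 1 ≤ U n ω ∧ U n ω < n then echoStep X ε ξ U (U n ω) ω else 0)
termination_by n
decreasing_by exact _h.2

/-- The position at time `n` of the random walk with echoed steps. -/
noncomputable def echoWalk {Ω : Type*} (X ε ξ : ℕ → Ω → ℝ) (U : ℕ → Ω → ℕ) (n : ℕ) (ω : Ω) : ℝ :=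
  ∑ k ∈ Finset.Icc 1 n, echoStep X ε ξ U k ω

/-- The family of all the driving variables `X_n` (`n ≥ 1`), `ε_n`, `U[n]`, `ξ_n` (`n ≥ 2`),
the natural numbers `U[n]` being read as real numbers. -/
def drivingFamily {Ω : Type*} (X ε ξ : ℕ → Ω → ℝ) (U : ℕ → Ω → ℕ) :
    ({n : ℕ // 1 ≤ n} ⊕ {n : ℕ // 2 ≤ n} ⊕ {n : ℕ // 2 ≤ n} ⊕ {n : ℕ // 2 ≤ n}) → Ω → ℝ :=
  Sum.elim (fun n => X n) (Sum.elim (fun n => ε n)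
    (Sum.elim (fun n ω => (U n ω : ℝ)) (fun n => ξ n)))

/-- The driving variables of a random walk with echoed steps with memory parameter `p`,
spin law `νX` and echo law `νξ`. -/
structure IsEchoInput {Ω : Type*} [MeasurableSpace Ω] (μ : Measure Ω) (p : ℝ)
    (νX νξ : Measure ℝ) (X ε ξ : ℕ → Ω → ℝ) (U : ℕ → Ω → ℕ) : Prop where
  measurable_spin : ∀ n, 1 ≤ n → Measurable (X n)
  measurable_bern : ∀ n, 2 ≤ n → Measurable (ε n)
  measurable_echo : ∀ n, 2 ≤ n → Measurable (ξ n)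
  measurable_unif : ∀ n, 2 ≤ n → Measurable (U n)
  /-- The spins have law `νX`. -/
  law_spin : ∀ n, 1 ≤ n → μ.map (X n) = νX
  /-- The echo variables have law `νξ`. -/
  law_echo : ∀ n, 2 ≤ n → μ.map (ξ n) = νξ
  /-- `ε_n` is Bernoulli with parameter `p`. -/
  law_bern_one : ∀ n, 2 ≤ n → μ {ω | ε n ω = 1} = ENNReal.ofReal p
  law_bern_zero : ∀ n, 2 ≤ n → μ {ω | ε n ω = 0} = ENNReal.ofReal (1 - p)
  /-- `U[n]` is uniform on `{1, …, n - 1}`. -/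
  law_unif : ∀ n, 2 ≤ n → ∀ k, 1 ≤ k → k < n → μ {ω | U n ω = k} = ((n - 1 : ℕ) : ENNReal)⁻¹
  /-- All the driving variables are mutually independent. -/
  indep : iIndepFun (drivingFamily X ε ξ U) μ

/-- `Z n → c` almost surely and in `L^γ(μ)`. -/
def TendstoASAndLp {Ω : Type*} [MeasurableSpace Ω] (μ : Measure Ω) (γ : ℝ)
    (Z : ℕ → Ω → ℝ) (c : ℝ) : Prop :=
  (∀ᵐ ω ∂μ, Tendsto (fun n => Z n ω) atTop (𝓝 c)) ∧
  (∀ n, MemLp (Z n) (ENNReal.ofReal γ) μ) ∧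
  Tendsto (fun n => eLpNorm (fun ω => Z n ω - c) (ENNReal.ofReal γ) μ) atTop (𝓝 0)

/-!
Given the past, the next increment has conditional mean `c + q m`, where `m` is the average of the
increments so far, `c = (1 - p) E X` and `q = p E ξ`. Hence the running mean obeys a first-order
linear recursion driven by weighted martingale differences `(n + 2)⁻¹ d n`, and the limit of the
running mean follows once the noise series converges. That deterministic step holds in any normed
space, so it is applied once to each trajectory and once in `L^γ`.

For the noise series, multiplicativity of `x ↦ |x| ^ γ` gives the `γ`-th moments of the increments
a recursion of the same kind with `q` replaced by `p E |ξ| ^ γ`. If this is less than `γ`, the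
moments grow slowly enough for `∑ n ^ (-γ) E |d n| ^ γ` to converge, and the von Bahr–Esseen
inequality makes the series converge almost surely and in `L^γ`. A suitable `γ` slightly above `1`
exists because the derivative of `γ ↦ γ - p E |ξ| ^ γ` at `1` is `1 - p E[|ξ| log |ξ|]`.
-/

section Recursion

variable {E : Type*} [NormedAddCommGroup E] [NormedSpace ℝ E]

theorem sub_le_exp_mul_of_contraction {u a : ℕ → ℝ} {δ : ℝ} {N : ℕ} (hu : ∀ n, 0 ≤ u n)
    (ha : ∀ n, N ≤ n → a n ∈ Set.Icc 0 1)
    (hrec : ∀ n, N ≤ n → u (n + 1) ≤ (1 - a n) * u n + a n * δ) (hδ : 0 ≤ δ)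
    {n : ℕ} (hn : N ≤ n) :
    u n - δ ≤ Real.exp (-(∑ k ∈ Finset.range n, a k - ∑ k ∈ Finset.range N, a k)) * u N := by
  induction n, hn using Nat.le_induction with
  | base => simpa using hδ
  | succ n hn ih =>
    set D := ∑ k ∈ Finset.range n, a k - ∑ k ∈ Finset.range N, a k with hD
    calc u (n + 1) - δ ≤ (1 - a n) * (u n - δ) := by linarith [hrec n hn]
      _ ≤ (1 - a n) * (Real.exp (-D) * u N) :=
          mul_le_mul_of_nonneg_left ih (sub_nonneg.2 (ha n hn).2)
      _ ≤ Real.exp (-a n) * (Real.exp (-D) * u N) := by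
          gcongr
          · exact mul_nonneg (Real.exp_nonneg _) (hu N)
          · exact Real.one_sub_le_exp_neg _
      _ = Real.exp (-(∑ k ∈ Finset.range (n + 1), a k - ∑ k ∈ Finset.range N, a k)) * u N := by
          rw [← mul_assoc, ← Real.exp_add, Finset.sum_range_succ, hD]
          ring_nf

theorem tendsto_zero_of_contraction {u a e : ℕ → ℝ} (hu : ∀ n, 0 ≤ u n)
    (ha : ∀ᶠ n in atTop, a n ∈ Set.Icc 0 1)
    (hsum : Tendsto (fun n => ∑ k ∈ Finset.range n, a k) atTop atTop)
    (he : Tendsto e atTop (𝓝 0))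
    (hrec : ∀ᶠ n in atTop, u (n + 1) ≤ (1 - a n) * u n + a n * e n) :
    Tendsto u atTop (𝓝 0) := by
  refine tendsto_order.2 ⟨fun b hb => .of_forall fun n => hb.trans_le (hu n), fun b hb => ?_⟩
  obtain ⟨N, hN⟩ := eventually_atTop.1
    (ha.and (hrec.and (he.eventually_le_const (half_pos hb))))
  have hrec' : ∀ n, N ≤ n → u (n + 1) ≤ (1 - a n) * u n + a n * (b / 2) := fun n hn =>
    (hN n hn).2.1.trans <| by gcongr; exacts [(hN n hn).1.1, (hN n hn).2.2]
  have hdecay : Tendsto (fun n => Real.exp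
      (-(∑ k ∈ Finset.range n, a k - ∑ k ∈ Finset.range N, a k)) * u N) atTop (𝓝 0) := by
    simpa only [zero_mul, sub_eq_add_neg, Function.comp_def] using
      (Real.tendsto_exp_neg_atTop_nhds_zero.comp
        (tendsto_atTop_add_const_right _ (-∑ k ∈ Finset.range N, a k) hsum)).mul_const (u N)
  filter_upwards [hdecay.eventually_lt_const (half_pos hb), eventually_ge_atTop N] with n hn hNn
  linarith [sub_le_exp_mul_of_contraction hu (fun n hn => (hN n hn).1) hrec' (half_pos hb).le hNn]

theorem tendsto_sum_div_atTop {θ : ℝ} (hθ : 0 < θ) :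
    Tendsto (fun n => ∑ k ∈ Finset.range n, θ / ((k : ℝ) + 2)) atTop atTop := by
  have hshift := tendsto_atTop_add_const_right _ (-1)
    ((tendsto_add_atTop_iff_nat 1).2 Real.tendsto_sum_range_one_div_nat_succ_atTop)
  refine (hshift.const_mul_atTop hθ).congr fun n => ?_
  simp only [Finset.sum_range_succ', Nat.cast_add, Nat.cast_one, Nat.cast_zero, zero_add, div_one,
    add_neg_cancel_right, Finset.mul_sum, mul_one_div, add_assoc (_ : ℝ) 1 1, one_add_one_eq_two]

theorem tendsto_zero_of_linear_recursion {θ : ℝ} (hθ : 0 < θ) {w d : ℕ → E} {L : E}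
    (hrec : ∀ n, w (n + 1) = (1 - θ / ((n : ℝ) + 2)) • w n + d n)
    (hd : Tendsto (fun n => ∑ k ∈ Finset.range n, d k) atTop (𝓝 L)) :
    Tendsto w atTop (𝓝 0) := by
  set r : ℕ → E := fun n => L - ∑ k ∈ Finset.range n, d k
  have hr : Tendsto r atTop (𝓝 0) := by simpa [r] using hd.const_sub L
  have hw : ∀ n, w (n + 1) + r (n + 1)
      = (1 - θ / ((n : ℝ) + 2)) • (w n + r n) + (θ / ((n : ℝ) + 2)) • r n := fun n => by
    simp only [r, hrec, Finset.sum_range_succ]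
    module
  have hθn : ∀ᶠ n : ℕ in atTop, θ / ((n : ℝ) + 2) ∈ Set.Icc 0 1 := by
    filter_upwards [eventually_ge_atTop ⌈θ⌉₊] with n hn
    refine ⟨by positivity, (div_le_one (by positivity)).2 ?_⟩
    linarith [Nat.ceil_le.1 hn]
  have hz : Tendsto (fun n => ‖w n + r n‖) atTop (𝓝 0) := by
    refine tendsto_zero_of_contraction (fun n => norm_nonneg _) hθn (tendsto_sum_div_atTop hθ)
      (tendsto_zero_iff_norm_tendsto_zero.1 hr) ?_
    filter_upwards [hθn] with n hn
    rw [hw]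
    refine (norm_add_le _ _).trans_eq ?_
    rw [norm_smul, norm_smul, Real.norm_of_nonneg (sub_nonneg.2 hn.2), Real.norm_of_nonneg hn.1]
  simpa using (tendsto_zero_iff_norm_tendsto_zero.2 hz).sub hr

theorem tendsto_sum_inv_div_log :
    Tendsto (fun n : ℕ => (∑ k ∈ Finset.range n, ((k : ℝ) + 2)⁻¹) / Real.log ((n : ℝ) + 1))
      atTop (𝓝 1) := by
  have hlog : Tendsto (fun n : ℕ => Real.log ((n : ℝ) + 1)) atTop atTop :=
    Real.tendsto_log_atTop.comp (tendsto_atTop_add_const_right _ _ tendsto_natCast_atTop_atTop)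
  have hharm : Tendsto (fun n : ℕ => ∑ k ∈ Finset.range n, ((k : ℝ) + 2)⁻¹
      - Real.log ((n : ℝ) + 1)) atTop (𝓝 (Real.eulerMascheroniConstant - 1)) := by
    refine (((tendsto_add_atTop_iff_nat 1).2 Real.tendsto_harmonic_sub_log).sub_const 1).congr
      fun n => ?_
    simp only [harmonic, Finset.sum_range_succ', Nat.cast_add, Nat.cast_one, Nat.cast_zero,
      Rat.cast_add, Rat.cast_sum, Rat.cast_inv, Rat.cast_natCast, Rat.cast_one,
      zero_add, inv_one, add_assoc, one_add_one_eq_two, Rat.cast_ofNat]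
    ring
  have hone := (hharm.div_atTop hlog).add_const 1
  rw [zero_add] at hone
  refine hone.congr' ?_
  filter_upwards [hlog.eventually_gt_atTop 0] with n hn
  field_simp
  ring

end Recursion

section RunningMean

/-- The average of the first `n + 1` terms of a sequence. -/
noncomputable def runningMean {E : Type*} [AddCommGroup E] [Module ℝ E] (y : ℕ → E) (n : ℕ) : E :=
  ((n : ℝ) + 1)⁻¹ • ∑ k ∈ Finset.range (n + 1), y k

/-- The deviation of `y (n + 1)` from its prediction `c + q • runningMean y n`, scaled by the weight
`(n + 2)⁻¹` with which it enters `runningMean y (n + 1)`. -/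
noncomputable def innovation {E : Type*} [AddCommGroup E] [Module ℝ E] (c : E) (q : ℝ) (y : ℕ → E)
    (n : ℕ) : E :=
  ((n : ℝ) + 2)⁻¹ • (y (n + 1) - (c + q • runningMean y n))

theorem runningMean_succ {E : Type*} [AddCommGroup E] [Module ℝ E] (c : E) (q : ℝ) (y : ℕ → E)
    (n : ℕ) :
    runningMean y (n + 1) = (1 - (1 - q) / ((n : ℝ) + 2)) • runningMean y n
      + ((n : ℝ) + 2)⁻¹ • c + innovation c q y n := by
  have h1 : (n : ℝ) + 1 ≠ 0 := by positivity
  have h2 : (n : ℝ) + 2 ≠ 0 := by positivity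
  have hcast : ((n + 1 : ℕ) : ℝ) + 1 = n + 2 := by push_cast; ring
  rw [innovation, runningMean, runningMean, Finset.sum_range_succ, hcast]
  match_scalars <;> field_simp <;> ring

variable {E : Type*} [NormedAddCommGroup E] [NormedSpace ℝ E] {c L : E} {y : ℕ → E}

theorem tendsto_runningMean {q : ℝ} (hq : q < 1)
    (h : Tendsto (fun n => ∑ k ∈ Finset.range n, innovation c q y k) atTop (𝓝 L)) :
    Tendsto (runningMean y) atTop (𝓝 ((1 - q)⁻¹ • c)) := by
  have hq' : 1 - q ≠ 0 := (sub_pos.2 hq).ne'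
  rw [← tendsto_sub_nhds_zero_iff]
  refine tendsto_zero_of_linear_recursion (sub_pos.2 hq) (fun n => ?_) h
  have h2 : (n : ℝ) + 2 ≠ 0 := by positivity
  rw [runningMean_succ c q]
  match_scalars
  · ring
  · field_simp
    ring
  · ring

theorem runningMean_eq_sum_innovation (c : E) (y : ℕ → E) (n : ℕ) :
    runningMean y n = y 0 + (∑ k ∈ Finset.range n, ((k : ℝ) + 2)⁻¹) • c
      + ∑ k ∈ Finset.range n, innovation c 1 y k := by
  induction n with
  | zero => simp [runningMean]
  | succ n ih =>
    rw [runningMean_succ c 1, ih, Finset.sum_range_succ, Finset.sum_range_succ]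
    module

theorem tendsto_runningMean_div_log
    (h : Tendsto (fun n => ∑ k ∈ Finset.range n, innovation c 1 y k) atTop (𝓝 L)) :
    Tendsto (fun n : ℕ => (Real.log ((n : ℝ) + 1))⁻¹ • runningMean y n) atTop (𝓝 c) := by
  have hlog : Tendsto (fun n : ℕ => (Real.log ((n : ℝ) + 1))⁻¹) atTop (𝓝 0) :=
    (Real.tendsto_log_atTop.comp
      (tendsto_atTop_add_const_right _ _ tendsto_natCast_atTop_atTop)).inv_tendsto_atTop
  have hlim := (hlog.smul (h.const_add (y 0))).add (tendsto_sum_inv_div_log.smul_const c)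
  rw [zero_smul, one_smul, zero_add] at hlim
  refine hlim.congr fun n => ?_
  rw [runningMean_eq_sum_innovation c]
  module

end RunningMean

section Growth

theorem rpow_mul_one_add_div_le {x r : ℝ} (hx : 0 < x) (hr : 1 ≤ r) :
    x ^ r * (1 + r / x) ≤ (x + 1) ^ r := by
  have hbern := one_add_mul_self_le_rpow_one_add (s := x⁻¹) (by linarith [inv_pos.2 hx]) hr
  calc x ^ r * (1 + r / x) ≤ x ^ r * (1 + x⁻¹) ^ r := by rw [div_eq_mul_inv]; gcongr
    _ = (x + 1) ^ r := by
        rw [← Real.mul_rpow hx.le (by positivity), mul_one_add, mul_inv_cancel₀ hx.ne']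

variable {u : ℕ → ℝ} {a ρ : ℝ}

theorem exists_sum_le_mul_rpow {r : ℝ} (hu0 : 0 ≤ u 0) (ha : 0 ≤ a) (hρ : 0 ≤ ρ) (hρr : ρ < r)
    (hr : 1 ≤ r) (hu : ∀ n, u (n + 1) ≤ a + ρ * runningMean u n) :
    ∃ K, 0 ≤ K ∧ ∀ n : ℕ, ∑ k ∈ Finset.range (n + 1), u k ≤ K * ((n : ℝ) + 1) ^ r := by
  have hr' : 0 < r - ρ := sub_pos.2 hρr
  obtain ⟨K, hK0, hKu, hKa⟩ : ∃ K, 0 ≤ K ∧ u 0 ≤ K ∧ a ≤ K * (r - ρ) :=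
    ⟨u 0 + a / (r - ρ), by positivity, le_add_of_nonneg_right (by positivity), by
      rw [add_mul, div_mul_cancel₀ _ hr'.ne']
      exact le_add_of_nonneg_left (by positivity)⟩
  refine ⟨K, hK0, fun n => ?_⟩
  induction n with
  | zero => simpa using hKu
  | succ n ih =>
    set V := ∑ k ∈ Finset.range (n + 1), u k
    set x : ℝ := n + 1
    have hmean : ρ * runningMean u n = ρ / x * V := by
      rw [runningMean, smul_eq_mul, ← mul_assoc, div_eq_mul_inv]
    have hx : 1 ≤ x := le_add_of_nonneg_left n.cast_nonneg
    have hx0 : 0 < x := zero_lt_one.trans_le hx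
    have hxr : 1 ≤ x ^ r / x := (one_le_div hx0).2 (Real.self_le_rpow_of_one_le hx hr)
    calc ∑ k ∈ Finset.range (n + 1 + 1), u k ≤ V + (a + ρ / x * V) := by
          rw [Finset.sum_range_succ]; gcongr; exact (hu n).trans_eq (by rw [hmean])
      _ = (1 + ρ / x) * V + a * 1 := by ring
      _ ≤ (1 + ρ / x) * (K * x ^ r) + K * (r - ρ) * (x ^ r / x) := by gcongr
      _ = K * (x ^ r * (1 + r / x)) := by ring
      _ ≤ K * (x + 1) ^ r := by gcongr; exact rpow_mul_one_add_div_le hx0 hr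
      _ = K * (((n + 1 : ℕ) : ℝ) + 1) ^ r := by rw [Nat.cast_succ]

theorem summable_rpow_neg_mul_of_le_runningMean {γ : ℝ} (hγ : 1 < γ) (hu0 : ∀ n, 0 ≤ u n)
    (ha : 0 ≤ a) (hρ : 0 ≤ ρ) (hργ : ρ < γ)
    (hu : ∀ n, u (n + 1) ≤ a + ρ * runningMean u n) :
    Summable fun n : ℕ => ((n : ℝ) + 2) ^ (-γ) * u (n + 1) := by
  obtain ⟨r, hr, hrγ⟩ := exists_between (max_lt hγ hργ)
  obtain ⟨h1r, hρr⟩ := max_lt_iff.1 hr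
  obtain ⟨K, hK, hsum⟩ := exists_sum_le_mul_rpow (hu0 0) ha hρ hρr h1r.le hu
  have hbound : ∀ n : ℕ, u (n + 1) ≤ (a + ρ * K) * ((n : ℝ) + 2) ^ (r - 1) := fun n => by
    have hx : (0 : ℝ) < (n : ℝ) + 1 := by positivity
    calc u (n + 1) ≤ a * 1 + ρ / ((n : ℝ) + 1) * (K * ((n : ℝ) + 1) ^ r) := by
          rw [mul_one, div_eq_mul_inv, mul_assoc]
          exact (hu n).trans (by rw [runningMean, smul_eq_mul]; gcongr; exact hsum n)
      _ = a * 1 + ρ * K * ((n : ℝ) + 1) ^ (r - 1) := by rw [Real.rpow_sub_one hx.ne']; ring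
      _ ≤ a * ((n : ℝ) + 2) ^ (r - 1) + ρ * K * ((n : ℝ) + 2) ^ (r - 1) := by
          gcongr
          · exact Real.one_le_rpow (by linarith) (by linarith)
          · linarith
      _ = (a + ρ * K) * ((n : ℝ) + 2) ^ (r - 1) := by ring
  refine .of_nonneg_of_le (fun n => mul_nonneg (by positivity) (hu0 _)) (fun n => ?_)
    (((Real.summable_one_div_nat_add_rpow 2 (γ - r + 1)).2 (by linarith)).mul_left (a + ρ * K))
  have hx : (0 : ℝ) < (n : ℝ) + 2 := by positivity
  calc ((n : ℝ) + 2) ^ (-γ) * u (n + 1)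
      ≤ ((n : ℝ) + 2) ^ (-γ) * ((a + ρ * K) * ((n : ℝ) + 2) ^ (r - 1)) := by gcongr; exact hbound n
    _ = (a + ρ * K) * (1 / |(n : ℝ) + 2| ^ (γ - r + 1)) := by
        rw [abs_of_pos hx, one_div, ← Real.rpow_neg hx.le, mul_left_comm, ← Real.rpow_add hx]
        ring_nf

end Growth

section RpowInequalities

theorem abs_one_add_rpow_le {γ : ℝ} (h1 : 1 ≤ γ) (h2 : γ ≤ 2) (t : ℝ) :
    |1 + t| ^ γ ≤ 1 + γ * t + 2 * |t| ^ γ := by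
  have hsplit : ∀ x : ℝ, 0 ≤ x → x ^ γ = x * x ^ (γ - 1) := fun x hx => by
    rw [← Real.rpow_one_add' hx (by linarith), add_sub_cancel]
  rcases le_total t (-1) with ht | ht
  · have hbern := one_add_mul_self_le_rpow_one_add (s := |t| - 1) (by linarith [abs_nonneg t]) h1
    rw [add_sub_cancel, abs_of_nonpos (by linarith : t ≤ 0)] at hbern
    rw [abs_of_nonpos (by linarith : 1 + t ≤ 0), abs_of_nonpos (by linarith : t ≤ 0)]
    have hmono : (-(1 + t)) ^ γ ≤ (-t) ^ γ := by gcongr <;> linarith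
    nlinarith
  rw [abs_of_nonneg (by linarith : 0 ≤ 1 + t), hsplit (1 + t) (by linarith)]
  rcases le_total t 1 with ht1 | ht1
  · have hsq : t ^ 2 ≤ |t| ^ γ := by
      rw [← sq_abs, ← Real.rpow_two]
      exact Real.rpow_le_rpow_of_exponent_ge_of_imp (abs_nonneg t) (abs_le.2 ⟨ht, ht1⟩) h2
        fun _ hγ => by linarith
    have hconc := rpow_one_add_le_one_add_mul_self ht (by linarith : 0 ≤ γ - 1) (by linarith)
    nlinarith [mul_le_mul_of_nonneg_left hconc (by linarith : 0 ≤ 1 + t), sq_nonneg t]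
  · have hsub := Real.rpow_add_le_add_rpow (p := γ - 1) zero_le_one (zero_le_one.trans ht1)
      (by linarith) (by linarith)
    have hmono : t ^ (γ - 1) ≤ t ^ γ := Real.rpow_le_rpow_of_exponent_le ht1 (by linarith)
    rw [Real.one_rpow] at hsub
    rw [abs_of_nonneg (by linarith : 0 ≤ t)]
    nlinarith [mul_le_mul_of_nonneg_left hsub (by linarith : 0 ≤ 1 + t),
      hsplit t (by linarith)]

-- `|a| ^ γ / a` is the odd power `sgn a * |a| ^ (γ - 1)`; at `a = 0` division by zero gives `0`.
theorem abs_add_rpow_le {γ : ℝ} (h1 : 1 ≤ γ) (h2 : γ ≤ 2) (a b : ℝ) :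
    |a + b| ^ γ ≤ |a| ^ γ + γ * (|a| ^ γ / a * b) + 2 * |b| ^ γ := by
  have hb : 0 ≤ |b| ^ γ := by positivity
  rcases eq_or_ne a 0 with rfl | ha
  · rw [zero_add, abs_zero, Real.zero_rpow (by linarith), zero_div]
    linarith
  have hscale : ∀ s : ℝ, |a| ^ γ * |s| ^ γ = |a * s| ^ γ := fun s => by
    rw [abs_mul, Real.mul_rpow (abs_nonneg a) (abs_nonneg s)]
  calc |a + b| ^ γ = |a| ^ γ * |1 + b / a| ^ γ := by rw [hscale]; congr 2; field_simp
    _ ≤ |a| ^ γ * (1 + γ * (b / a) + 2 * |b / a| ^ γ) := by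
        gcongr; exact abs_one_add_rpow_le h1 h2 _
    _ = |a| ^ γ + γ * (|a| ^ γ / a * b) + 2 * (|a| ^ γ * |b / a| ^ γ) := by ring
    _ = |a| ^ γ + γ * (|a| ^ γ / a * b) + 2 * |b| ^ γ := by
        rw [hscale, mul_div_cancel₀ b ha]

theorem abs_rpow_div_mul_le {γ : ℝ} (h1 : 1 ≤ γ) (a b : ℝ) :
    |(|a| ^ γ / a * b)| ≤ |a| ^ γ + |b| ^ γ := by
  set M := max |a| |b| with hM
  have hM0 : 0 ≤ M := (abs_nonneg a).trans (le_max_left _ _)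
  have hdiv : |a| ^ γ / |a| ≤ M ^ (γ - 1) := by
    rcases eq_or_ne a 0 with rfl | ha
    · rw [abs_zero, div_zero]; positivity
    · rw [← Real.rpow_sub_one (abs_pos.2 ha).ne']
      exact Real.rpow_le_rpow (abs_nonneg a) (le_max_left _ _) (by linarith)
  calc |(|a| ^ γ / a * b)| = |a| ^ γ / |a| * |b| := by
        rw [abs_mul, abs_div, abs_of_nonneg (by positivity : 0 ≤ |a| ^ γ)]
    _ ≤ M ^ (γ - 1) * M := by gcongr; exact le_max_right _ _
    _ = M ^ γ := by rw [← Real.rpow_add_one' hM0 (by linarith), sub_add_cancel]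
    _ ≤ |a| ^ γ + |b| ^ γ := by
        rcases max_choice |a| |b| with h | h <;> rw [hM, h]
        · exact le_add_of_nonneg_right (by positivity)
        · exact le_add_of_nonneg_left (by positivity)

end RpowInequalities

section AbsMoments

variable {Ω : Type*} {m0 : MeasurableSpace Ω} {μ : Measure Ω} {γ : ℝ} {f : Ω → ℝ}

theorem integrable_abs_rpow_of_memLp (hγ : 0 < γ) (hf : MemLp f (ENNReal.ofReal γ) μ) :
    Integrable (fun ω => |f ω| ^ γ) μ := by
  simpa only [Real.norm_eq_abs, ENNReal.toReal_ofReal hγ.le] using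
    hf.integrable_norm_rpow (ENNReal.ofReal_pos.2 hγ).ne' ENNReal.ofReal_ne_top

theorem memLp_of_integrable_abs_rpow (hγ : 0 < γ) (hf : AEStronglyMeasurable f μ)
    (hint : Integrable (fun ω => |f ω| ^ γ) μ) : MemLp f (ENNReal.ofReal γ) μ := by
  rw [← integrable_norm_rpow_iff hf (ENNReal.ofReal_pos.2 hγ).ne' ENNReal.ofReal_ne_top]
  simpa only [Real.norm_eq_abs, ENNReal.toReal_ofReal hγ.le] using hint

theorem integral_abs_rpow_eq_norm_toLp (hγ : 0 < γ) (hf : MemLp f (ENNReal.ofReal γ) μ) :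
    ∫ ω, |f ω| ^ γ ∂μ = ‖hf.toLp f‖ ^ γ := by
  rw [Lp.norm_toLp, hf.eLpNorm_eq_integral_rpow_norm (ENNReal.ofReal_pos.2 hγ).ne'
    ENNReal.ofReal_ne_top, ENNReal.toReal_ofReal hγ.le, ENNReal.toReal_ofReal (by positivity),
    Real.rpow_inv_rpow (by positivity) hγ.ne']
  simp only [Real.norm_eq_abs]

theorem integral_abs_sub_condExp_rpow_le [IsFiniteMeasure μ] (hγ : 1 ≤ γ)
    (hf : MemLp f (ENNReal.ofReal γ) μ) (m : MeasurableSpace Ω) :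
    ∫ ω, |f ω - (μ[f|m]) ω| ^ γ ∂μ ≤ 2 ^ γ * ∫ ω, |f ω| ^ γ ∂μ := by
  have hγ0 : 0 < γ := by linarith
  have : Fact (1 ≤ ENNReal.ofReal γ) := ⟨ENNReal.one_le_ofReal.2 hγ⟩
  have hcond : MemLp (μ[f|m]) (ENNReal.ofReal γ) μ := hf.condExp Fact.out
  have hcontract : ‖hcond.toLp (μ[f|m])‖ ≤ ‖hf.toLp f‖ := by
    rw [Lp.norm_toLp, Lp.norm_toLp]
    exact ENNReal.toReal_mono hf.2.ne (eLpNorm_condExp_le_eLpNorm f Fact.out)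
  calc ∫ ω, |f ω - (μ[f|m]) ω| ^ γ ∂μ = ‖hf.toLp f - hcond.toLp (μ[f|m])‖ ^ γ := by
        rw [← MemLp.toLp_sub, ← integral_abs_rpow_eq_norm_toLp hγ0]
        rfl
    _ ≤ (2 * ‖hf.toLp f‖) ^ γ := by
        gcongr
        linarith [norm_sub_le (hf.toLp f) (hcond.toLp (μ[f|m]))]
    _ = 2 ^ γ * ∫ ω, |f ω| ^ γ ∂μ := by
        rw [Real.mul_rpow zero_le_two (norm_nonneg _), integral_abs_rpow_eq_norm_toLp hγ0 hf]

end AbsMoments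

section VonBahrEsseen

variable {Ω : Type*} {m0 : MeasurableSpace Ω} {μ : Measure Ω} [IsFiniteMeasure μ] {γ : ℝ}

theorem integral_rpow_div_mul_eq_zero {m : MeasurableSpace Ω} (hm : m ≤ m0) (h1 : 1 ≤ γ)
    {A D : Ω → ℝ} (hAm : StronglyMeasurable[m] A) (hA : MemLp A (ENNReal.ofReal γ) μ)
    (hD : MemLp D (ENNReal.ofReal γ) μ) (hD0 : μ[D | m] =ᵐ[μ] 0) :
    Integrable (fun ω => |A ω| ^ γ / A ω * D ω) μ ∧ ∫ ω, |A ω| ^ γ / A ω * D ω ∂μ = 0 := by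
  have hγ : 0 < γ := by linarith
  have hweight : StronglyMeasurable[m] fun ω => |A ω| ^ γ / A ω :=
    ((hAm.measurable.abs.pow_const γ).div hAm.measurable).stronglyMeasurable
  have hint : Integrable (fun ω => |A ω| ^ γ / A ω * D ω) μ :=
    ((integrable_abs_rpow_of_memLp hγ hA).add (integrable_abs_rpow_of_memLp hγ hD)).mono'
      ((hweight.mono hm).aestronglyMeasurable.mul hD.1)
      (ae_of_all _ fun ω => abs_rpow_div_mul_le h1 _ _)
  refine ⟨hint, ?_⟩
  rw [← integral_condExp hm]
  refine integral_eq_zero_of_ae ?_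
  filter_upwards [condExp_mul_of_stronglyMeasurable_left hweight hint
    (hD.integrable (ENNReal.one_le_ofReal.2 h1)), hD0] with ω hω hω0
  exact hω.trans (by rw [Pi.mul_apply, hω0, Pi.zero_apply, mul_zero])

theorem integral_abs_add_rpow_le_of_condExp_eq_zero {m : MeasurableSpace Ω} (hm : m ≤ m0)
    (h1 : 1 ≤ γ) (h2 : γ ≤ 2) {A D : Ω → ℝ} (hAm : StronglyMeasurable[m] A)
    (hA : MemLp A (ENNReal.ofReal γ) μ) (hD : MemLp D (ENNReal.ofReal γ) μ)
    (hD0 : μ[D | m] =ᵐ[μ] 0) :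
    ∫ ω, |A ω + D ω| ^ γ ∂μ ≤ ∫ ω, |A ω| ^ γ ∂μ + 2 * ∫ ω, |D ω| ^ γ ∂μ := by
  have hγ : 0 < γ := by linarith
  obtain ⟨hcross, hcross0⟩ := integral_rpow_div_mul_eq_zero hm h1 hAm hA hD hD0
  have hA' := integrable_abs_rpow_of_memLp hγ hA
  have hD' := integrable_abs_rpow_of_memLp hγ hD
  calc ∫ ω, |A ω + D ω| ^ γ ∂μ
      ≤ ∫ ω, (|A ω| ^ γ + γ * (|A ω| ^ γ / A ω * D ω) + 2 * |D ω| ^ γ) ∂μ :=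
        integral_mono (integrable_abs_rpow_of_memLp hγ (hA.add hD))
          ((hA'.add (hcross.const_mul γ)).add (hD'.const_mul 2))
          fun ω => abs_add_rpow_le h1 h2 _ _
    _ = ∫ ω, |A ω| ^ γ ∂μ + 2 * ∫ ω, |D ω| ^ γ ∂μ := by
        rw [integral_add (f := fun ω => |A ω| ^ γ + γ * (|A ω| ^ γ / A ω * D ω))
          (hA'.add (hcross.const_mul γ)) (hD'.const_mul 2),
          integral_add hA' (hcross.const_mul γ), integral_const_mul, integral_const_mul, hcross0,
          mul_zero, add_zero]

variable {𝓕 : Filtration ℕ m0} {M : ℕ → Ω → ℝ}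

theorem integral_abs_sub_rpow_le_sum (h1 : 1 ≤ γ) (h2 : γ ≤ 2) (hM : Martingale M 𝓕 μ)
    (hMγ : ∀ n, MemLp (M n) (ENNReal.ofReal γ) μ) {m n : ℕ} (hmn : m ≤ n) :
    ∫ ω, |M n ω - M m ω| ^ γ ∂μ
      ≤ 2 * ∑ k ∈ Finset.Ico m n, ∫ ω, |M (k + 1) ω - M k ω| ^ γ ∂μ := by
  induction n, hmn using Nat.le_induction with
  | base => simp [Real.zero_rpow (by linarith : γ ≠ 0)]
  | succ n hmn ih =>
    have hadapted : StronglyMeasurable[𝓕 n] (M n - M m) :=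
      (hM.stronglyAdapted n).sub ((hM.stronglyAdapted m).mono (𝓕.mono hmn))
    have hcentred : μ[M (n + 1) - M n|𝓕 n] =ᵐ[μ] 0 := by
      filter_upwards [condExp_sub (hM.integrable (n + 1)) (hM.integrable n) (𝓕 n),
        hM.condExp_ae_eq n.le_succ, hM.condExp_ae_eq le_rfl] with ω hsub hnext hself
      rw [hsub, Pi.sub_apply, hnext, hself, sub_self, Pi.zero_apply]
    have hstep := integral_abs_add_rpow_le_of_condExp_eq_zero (𝓕.le n) h1 h2 hadapted
      ((hMγ n).sub (hMγ m)) ((hMγ (n + 1)).sub (hMγ n)) hcentred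
    simp only [Pi.sub_apply, add_comm (M n _ - M m _), sub_add_sub_cancel] at hstep
    rw [Finset.sum_Ico_succ_top hmn, mul_add]
    linarith

theorem exists_tendsto_toLp_of_summable [Fact (1 ≤ ENNReal.ofReal γ)] (h2 : γ ≤ 2)
    (hM : Martingale M 𝓕 μ) (hMγ : ∀ n, MemLp (M n) (ENNReal.ofReal γ) μ)
    (hsum : Summable fun n => ∫ ω, |M (n + 1) ω - M n ω| ^ γ ∂μ) :
    ∃ L, Tendsto (fun n => (hMγ n).toLp (M n)) atTop (𝓝 L) := by
  have h1 : 1 ≤ γ := ENNReal.one_le_ofReal.1 Fact.out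
  set v : ℕ → ℝ := fun n => ∫ ω, |M (n + 1) ω - M n ω| ^ γ ∂μ
  have hv : ∀ n, 0 ≤ v n := fun n => integral_nonneg fun ω => by positivity
  set tail : ℕ → ℝ := fun n => (2 * ∑' k, v (k + n)) ^ γ⁻¹
  have htail : Tendsto tail atTop (𝓝 0) := by
    have := ((tendsto_sum_nat_add v).const_mul 2).rpow_const (p := γ⁻¹)
      (.inr (by positivity))
    rwa [mul_zero, Real.zero_rpow (inv_ne_zero (by linarith))] at this
  refine cauchySeq_tendsto_of_complete (cauchySeq_of_le_tendsto_0' tail (fun m n hmn => ?_) htail)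
  rw [dist_comm, dist_eq_norm, ← MemLp.toLp_sub, Real.le_rpow_inv_iff_of_pos (norm_nonneg _)
    (mul_nonneg zero_le_two (tsum_nonneg fun k => hv _)) (by linarith),
    ← integral_abs_rpow_eq_norm_toLp (by linarith)]
  refine (integral_abs_sub_rpow_le_sum h1 h2 hM hMγ hmn).trans ?_
  gcongr
  rw [Finset.sum_Ico_eq_sum_range]
  simp only [add_comm m]
  exact ((summable_nat_add_iff m).2 hsum).sum_le_tsum _ fun k _ => hv _

theorem exists_ae_tendsto_of_tendsto_toLp {p : ENNReal} [Fact (1 ≤ p)] (hM : Martingale M 𝓕 μ)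
    (hMp : ∀ n, MemLp (M n) p μ) {L : Lp ℝ p μ}
    (hL : Tendsto (fun n => (hMp n).toLp (M n)) atTop (𝓝 L)) :
    ∀ᵐ ω ∂μ, ∃ l, Tendsto (fun n => M n ω) atTop (𝓝 l) := by
  obtain ⟨K, hK⟩ := hL.norm.bddAbove_range
  have hp : 0 ≤ 1 / (1 : ENNReal).toReal - 1 / p.toReal := by
    rcases eq_or_ne p ⊤ with rfl | htop
    · simp
    · have := ENNReal.toReal_mono htop (Fact.out : 1 ≤ p)
      rw [ENNReal.toReal_one] at this ⊢
      rw [div_one, sub_nonneg]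
      exact div_le_one_of_le₀ this (by positivity)
  set C := ENNReal.ofReal K * μ Set.univ ^ (1 / (1 : ENNReal).toReal - 1 / p.toReal)
  have hC : C ≠ ⊤ := ENNReal.mul_ne_top ENNReal.ofReal_ne_top
    (ENNReal.rpow_ne_top_of_nonneg hp (measure_ne_top _ _))
  refine hM.submartingale.exists_ae_tendsto_of_bdd (R := C.toNNReal) fun n => ?_
  rw [ENNReal.coe_toNNReal hC]
  refine (eLpNorm_le_eLpNorm_mul_rpow_measure_univ (Fact.out : 1 ≤ p) (hMp n).1).trans
    (mul_le_mul_left ?_ _)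
  rw [← ENNReal.ofReal_toReal (hMp n).2.ne, ← Lp.norm_toLp _ (hMp n)]
  exact ENNReal.ofReal_le_ofReal (hK (Set.mem_range_self n))

end VonBahrEsseen

section AffineDrift

variable {Ω : Type*} {m0 : MeasurableSpace Ω} {μ : Measure Ω} {y : ℕ → Ω → ℝ}

/-- A process whose next value has conditional mean `c + q m`, where `m` is the average of the
values observed so far. Time is indexed from `0`. -/
structure HasAffineDrift (μ : Measure Ω) (𝓕 : Filtration ℕ m0) (y : ℕ → Ω → ℝ) (c q : ℝ) :
    Prop where
  stronglyAdapted : StronglyAdapted 𝓕 y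
  condExp_eq : ∀ n, μ[y (n + 1)|𝓕 n] =ᵐ[μ] fun ω => c + q * runningMean (y · ω) n

namespace HasAffineDrift

variable {𝓕 : Filtration ℕ m0} {c q : ℝ}

theorem stronglyMeasurable_innovation (h : HasAffineDrift μ 𝓕 y c q) (n : ℕ) :
    StronglyMeasurable[𝓕 (n + 1)] fun ω => innovation c q (y · ω) n := by
  have hmean : StronglyMeasurable[𝓕 (n + 1)] fun ω => runningMean (y · ω) n :=
    (Finset.stronglyMeasurable_fun_sum (Finset.range (n + 1)) fun k hk =>
      (h.stronglyAdapted k).mono (𝓕.mono (Finset.mem_range.1 hk).le)).const_smul ((n : ℝ) + 1)⁻¹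
  have hdev : StronglyMeasurable[𝓕 (n + 1)] fun ω =>
      y (n + 1) ω - (c + q * runningMean (y · ω) n) :=
    (h.stronglyAdapted (n + 1)).sub (stronglyMeasurable_const.add (hmean.const_mul q))
  exact hdev.const_smul ((n : ℝ) + 2)⁻¹

theorem innovation_ae_eq (h : HasAffineDrift μ 𝓕 y c q) (n : ℕ) :
    (fun ω => innovation c q (y · ω) n)
      =ᵐ[μ] ((n : ℝ) + 2)⁻¹ • (y (n + 1) - μ[y (n + 1)|𝓕 n]) := by
  filter_upwards [h.condExp_eq n] with ω hω
  rw [Pi.smul_apply, Pi.sub_apply, hω]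
  rfl

theorem memLp_innovation (h : HasAffineDrift μ 𝓕 y c q) {p : ENNReal} (hp : 1 ≤ p)
    (hy : ∀ n, MemLp (y n) p μ) (n : ℕ) : MemLp (fun ω => innovation c q (y · ω) n) p μ :=
  (((hy (n + 1)).sub ((hy (n + 1)).condExp hp)).const_smul _).ae_eq (h.innovation_ae_eq n).symm

variable [IsFiniteMeasure μ]

theorem condExp_innovation (h : HasAffineDrift μ 𝓕 y c q) (hy : ∀ n, Integrable (y n) μ) (n : ℕ) :
    μ[fun ω => innovation c q (y · ω) n|𝓕 n] =ᵐ[μ] 0 := by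
  refine (condExp_congr_ae (h.innovation_ae_eq n)).trans ?_
  filter_upwards [condExp_smul (m := 𝓕 n) (μ := μ) ((n : ℝ) + 2)⁻¹
      (y (n + 1) - μ[y (n + 1)|𝓕 n]),
    condExp_sub (hy (n + 1)) integrable_condExp (𝓕 n)] with ω hsmul hsub
  rw [hsmul, Pi.smul_apply, hsub, Pi.sub_apply,
    condExp_of_stronglyMeasurable (𝓕.le n) stronglyMeasurable_condExp integrable_condExp, sub_self,
    smul_zero, Pi.zero_apply]

theorem martingale_sum_innovation (h : HasAffineDrift μ 𝓕 y c q) (hy : ∀ n, Integrable (y n) μ) :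
    Martingale (fun n ω => ∑ k ∈ Finset.range n, innovation c q (y · ω) k) 𝓕 μ := by
  have hyLp : ∀ n, MemLp (y n) 1 μ := fun n => memLp_one_iff_integrable.2 (hy n)
  refine martingale_of_condExp_sub_eq_zero_nat
    (fun n => Finset.stronglyMeasurable_fun_sum _ fun k hk =>
      (h.stronglyMeasurable_innovation k).mono (𝓕.mono (Finset.mem_range.1 hk)))
    (fun n => integrable_finsetSum _ fun k _ =>
      (h.memLp_innovation le_rfl hyLp k).integrable le_rfl)
    fun n => ?_
  refine (condExp_congr_ae (ae_of_all μ fun ω => ?_)).trans (h.condExp_innovation hy n)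
  rw [Pi.sub_apply, Finset.sum_range_succ, add_sub_cancel_left]

variable {γ : ℝ}

theorem integral_abs_innovation_rpow_le (h : HasAffineDrift μ 𝓕 y c q) (hγ : 1 ≤ γ)
    (hy : ∀ n, MemLp (y n) (ENNReal.ofReal γ) μ) (n : ℕ) :
    ∫ ω, |innovation c q (y · ω) n| ^ γ ∂μ
      ≤ 2 ^ γ * (((n : ℝ) + 2) ^ (-γ) * ∫ ω, |y (n + 1) ω| ^ γ ∂μ) := by
  have hn : (0 : ℝ) < n + 2 := by positivity
  calc ∫ ω, |innovation c q (y · ω) n| ^ γ ∂μ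
      = ∫ ω, ((n : ℝ) + 2) ^ (-γ) * |y (n + 1) ω - (μ[y (n + 1)|𝓕 n]) ω| ^ γ ∂μ := by
        refine integral_congr_ae ?_
        filter_upwards [h.innovation_ae_eq n] with ω hω
        rw [hω, Pi.smul_apply, Pi.sub_apply, smul_eq_mul, abs_mul, abs_of_pos (inv_pos.2 hn),
          Real.mul_rpow (by positivity) (abs_nonneg _), Real.rpow_neg hn.le, Real.inv_rpow hn.le]
    _ ≤ ((n : ℝ) + 2) ^ (-γ) * (2 ^ γ * ∫ ω, |y (n + 1) ω| ^ γ ∂μ) := by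
        rw [integral_const_mul]
        gcongr
        exact integral_abs_sub_condExp_rpow_le hγ (hy (n + 1)) (𝓕 n)
    _ = 2 ^ γ * (((n : ℝ) + 2) ^ (-γ) * ∫ ω, |y (n + 1) ω| ^ γ ∂μ) := mul_left_comm _ _ _

end HasAffineDrift

section Lp

variable {p : ENNReal}

theorem memLp_runningMean (hy : ∀ n, MemLp (y n) p μ) (n : ℕ) :
    MemLp (fun ω => runningMean (y · ω) n) p μ :=
  (memLp_finsetSum (Finset.range (n + 1)) fun k _ => hy k).const_smul ((n : ℝ) + 1)⁻¹

theorem runningMean_toLp (hy : ∀ n, MemLp (y n) p μ) (n : ℕ) :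
    runningMean (fun k => (hy k).toLp (y k)) n = (memLp_runningMean hy n).toLp _ := by
  refine Lp.ext ?_
  filter_upwards [Lp.coeFn_smul ((n : ℝ) + 1)⁻¹ (∑ k ∈ Finset.range (n + 1), (hy k).toLp (y k)),
    Lp.coeFn_fun_finsetSum (Finset.range (n + 1)) fun k => (hy k).toLp (y k),
    ae_all_iff.2 fun k => (hy k).coeFn_toLp,
    (memLp_runningMean hy n).coeFn_toLp] with ω hsmul hsum hval hmean
  rw [hmean, runningMean, hsmul, Pi.smul_apply, hsum]
  simp only [hval, runningMean]

theorem innovation_toLp [IsFiniteMeasure μ] (hy : ∀ n, MemLp (y n) p μ) (c q : ℝ) (n : ℕ)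
    (hinnov : MemLp (fun ω => innovation c q (y · ω) n) p μ) :
    innovation ((memLp_const c).toLp fun _ => c) q (fun k => (hy k).toLp (y k)) n
      = hinnov.toLp _ := by
  rw [innovation, runningMean_toLp, ← MemLp.toLp_const_smul, ← MemLp.toLp_add,
    ← MemLp.toLp_sub, ← MemLp.toLp_const_smul]
  rfl

end Lp

end AffineDrift

section AffineDriftLimits

variable {Ω : Type*} {m0 : MeasurableSpace Ω} {μ : Measure Ω} {γ : ℝ}

theorem tendstoASAndLp_of_succ {Z : ℕ → Ω → ℝ} {c : ℝ} (h0 : MemLp (Z 0) (ENNReal.ofReal γ) μ)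
    (h : TendstoASAndLp μ γ (fun n => Z (n + 1)) c) : TendstoASAndLp μ γ Z c :=
  ⟨h.1.mono fun ω => (tendsto_add_atTop_iff_nat (f := (Z · ω)) 1).1,
    fun n => n.casesOn h0 h.2.1, (tendsto_add_atTop_iff_nat 1).1 h.2.2⟩

variable [IsFiniteMeasure μ] [Fact (1 ≤ ENNReal.ofReal γ)]

theorem tendstoASAndLp_of_tendsto_toLp {Z : ℕ → Ω → ℝ} {c : ℝ}
    (hZ : ∀ n, MemLp (Z n) (ENNReal.ofReal γ) μ)
    (hae : ∀ᵐ ω ∂μ, Tendsto (fun n => Z n ω) atTop (𝓝 c))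
    (hLp : Tendsto (fun n => (hZ n).toLp (Z n)) atTop (𝓝 ((memLp_const c).toLp fun _ => c))) :
    TendstoASAndLp μ γ Z c :=
  ⟨hae, hZ, (Lp.tendsto_Lp_iff_tendsto_eLpNorm'' Z hZ (fun _ => c) (memLp_const c)).1 hLp⟩

namespace HasAffineDrift

variable {𝓕 : Filtration ℕ m0} {y : ℕ → Ω → ℝ} {c q : ℝ}

theorem exists_tendsto_sum_innovation (h : HasAffineDrift μ 𝓕 y c q) (hγ2 : γ ≤ 2)
    (hy : ∀ n, MemLp (y n) (ENNReal.ofReal γ) μ)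
    (hs : Summable fun n : ℕ => ((n : ℝ) + 2) ^ (-γ) * ∫ ω, |y (n + 1) ω| ^ γ ∂μ) :
    (∀ᵐ ω ∂μ, ∃ l, Tendsto (fun n => ∑ k ∈ Finset.range n, innovation c q (y · ω) k)
      atTop (𝓝 l)) ∧
    ∃ L, Tendsto (fun n => ∑ k ∈ Finset.range n, innovation ((memLp_const c).toLp fun _ => c) q
      (fun k => (hy k).toLp (y k)) k) atTop (𝓝 L) := by
  have hγ1 : 1 ≤ ENNReal.ofReal γ := Fact.out
  have hinnov := h.memLp_innovation hγ1 hy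
  have hM := h.martingale_sum_innovation fun n => (hy n).integrable hγ1
  have hMγ := fun n => memLp_finsetSum (Finset.range n) fun k _ => hinnov k
  have hsum : Summable fun n => ∫ ω, |∑ k ∈ Finset.range (n + 1), innovation c q (y · ω) k
      - ∑ k ∈ Finset.range n, innovation c q (y · ω) k| ^ γ ∂μ := by
    simp only [Finset.sum_range_succ_sub_sum]
    exact Summable.of_nonneg_of_le (fun n => integral_nonneg fun ω => by positivity)
      (h.integral_abs_innovation_rpow_le (ENNReal.one_le_ofReal.1 hγ1) hy) (hs.mul_left (2 ^ γ))
  obtain ⟨L, hL⟩ := exists_tendsto_toLp_of_summable hγ2 hM hMγ hsum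
  refine ⟨exists_ae_tendsto_of_tendsto_toLp hM hMγ hL, L, hL.congr fun n => Lp.ext ?_⟩
  filter_upwards [(hMγ n).coeFn_toLp, Lp.coeFn_fun_finsetSum (Finset.range n) fun k =>
      innovation ((memLp_const c).toLp fun _ => c) q (fun k => (hy k).toLp (y k)) k,
    ae_all_iff.2 fun k => (hinnov k).coeFn_toLp] with ω hpartial hsum hval
  rw [hpartial, hsum]
  simp only [innovation_toLp hy c q _ (hinnov _), hval]

theorem tendstoASAndLp_runningMean (h : HasAffineDrift μ 𝓕 y c q) (hq : q < 1) (hγ2 : γ ≤ 2)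
    (hy : ∀ n, MemLp (y n) (ENNReal.ofReal γ) μ)
    (hs : Summable fun n : ℕ => ((n : ℝ) + 2) ^ (-γ) * ∫ ω, |y (n + 1) ω| ^ γ ∂μ) :
    TendstoASAndLp μ γ (fun n ω => runningMean (y · ω) n) ((1 - q)⁻¹ * c) := by
  obtain ⟨hae, L, hL⟩ := h.exists_tendsto_sum_innovation hγ2 hy hs
  refine tendstoASAndLp_of_tendsto_toLp (memLp_runningMean hy) ?_ ?_
  · filter_upwards [hae] with ω ⟨l, hl⟩
    exact tendsto_runningMean hq hl
  · exact (tendsto_runningMean hq hL).congr (runningMean_toLp hy)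

theorem tendstoASAndLp_runningMean_div_log (h : HasAffineDrift μ 𝓕 y c 1) (hγ2 : γ ≤ 2)
    (hy : ∀ n, MemLp (y n) (ENNReal.ofReal γ) μ)
    (hs : Summable fun n : ℕ => ((n : ℝ) + 2) ^ (-γ) * ∫ ω, |y (n + 1) ω| ^ γ ∂μ) :
    TendstoASAndLp μ γ (fun n ω => (Real.log ((n : ℝ) + 1))⁻¹ * runningMean (y · ω) n) c := by
  obtain ⟨hae, L, hL⟩ := h.exists_tendsto_sum_innovation hγ2 hy hs
  refine tendstoASAndLp_of_tendsto_toLp (fun n => (memLp_runningMean hy n).const_mul _) ?_ ?_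
  · filter_upwards [hae] with ω ⟨l, hl⟩
    exact tendsto_runningMean_div_log hl
  · refine (tendsto_runningMean_div_log hL).congr fun n => ?_
    rw [runningMean_toLp hy, ← MemLp.toLp_const_smul]
    rfl

end HasAffineDrift

end AffineDriftLimits

section Exponent

theorem eventually_pos_nhdsGT_of_hasDerivAt {g : ℝ → ℝ} {g' x : ℝ} (hg : HasDerivAt g g' x)
    (hx : 0 ≤ g x) (hg' : g x = 0 → 0 < g') : ∀ᶠ s in 𝓝[>] x, 0 < g s := by
  rcases hx.eq_or_lt with h0 | hpos
  · have hsign := eventually_nhdsWithin_sign_eq_of_deriv_pos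
      (by rw [hg.deriv]; exact hg' h0.symm) h0.symm
    filter_upwards [hsign.filter_mono nhdsWithin_le_nhds, self_mem_nhdsWithin] with s hs hxs
    exact sign_eq_one_iff.1 (hs.trans (sign_pos (sub_pos.2 hxs)))
  · exact (hg.continuousAt.eventually (lt_mem_nhds hpos)).filter_mono nhdsWithin_le_nhds

variable {Ω : Type*} {m0 : MeasurableSpace Ω} {μ : Measure Ω} [IsFiniteMeasure μ] {f : Ω → ℝ}
  {α : ℝ}

theorem hasDerivAt_integral_abs_rpow (hf : MemLp f (ENNReal.ofReal α) μ) {t : ℝ} (ht : 0 < t)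
    (htα : t < α) :
    HasDerivAt (fun s => ∫ ω, |f ω| ^ s ∂μ) (∫ ω, |f ω| ^ t * Real.log (f ω) ∂μ) t := by
  set ν := μ.restrict {ω | f ω ≠ 0}
  set X : Ω → ℝ := fun ω => Real.log (f ω)
  have hexp : ∀ s, (fun ω => Real.exp (s * X ω)) =ᵐ[ν] fun ω => |f ω| ^ s := fun s => by
    filter_upwards [ae_restrict_mem₀
      (hf.1.aemeasurable.nullMeasurable (measurableSet_singleton 0).compl)] with ω hω
    rw [Real.rpow_def_of_pos (abs_pos.2 hω), Real.log_abs, mul_comm]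
  have hmgf : (fun s => ∫ ω, |f ω| ^ s ∂μ) =ᶠ[𝓝 t] mgf X ν := by
    filter_upwards [lt_mem_nhds ht] with s hs
    rw [mgf, integral_congr_ae (hexp s)]
    refine (setIntegral_eq_integral_of_forall_compl_eq_zero fun ω hω => ?_).symm
    rw [not_not.1 hω, abs_zero, Real.zero_rpow hs.ne']
  have hmem : t ∈ interior (integrableExpSet X ν) := by
    refine mem_interior.2 ⟨Set.Ioo 0 α, fun s hs => ?_, isOpen_Ioo, ht, htα⟩
    exact ((integrable_abs_rpow_of_memLp hs.1 (hf.mono_exponent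
      (ENNReal.ofReal_le_ofReal hs.2.le))).restrict).congr (hexp s).symm
  refine ((hasDerivAt_mgf hmem).congr_of_eventuallyEq hmgf).congr_deriv (Eq.symm ?_)
  calc ∫ ω, |f ω| ^ t * Real.log (f ω) ∂μ = ∫ ω, |f ω| ^ t * Real.log (f ω) ∂ν := by
        refine (setIntegral_eq_integral_of_forall_compl_eq_zero fun ω hω => ?_).symm
        rw [not_not.1 hω, Real.log_zero, mul_zero]
    _ = ∫ ω, X ω * Real.exp (t * X ω) ∂ν := by
        simp only [mul_comm (X _)]
        exact integral_congr_ae ((hexp t).mono fun ω hω => congrArg (· * X ω) hω.symm)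

theorem exists_exponent_mul_integral_abs_rpow_lt (hα : 1 < α) (hf : MemLp f (ENNReal.ofReal α) μ)
    {p : ℝ} (hp : p * ∫ ω, |f ω| ∂μ ≤ 1)
    (hlog : p * ∫ ω, |f ω| ∂μ = 1 → ∫ ω, |f ω| * Real.log |f ω| ∂μ < ∫ ω, |f ω| ∂μ) :
    ∃ γ, 1 < γ ∧ γ ≤ 2 ∧ γ ≤ α ∧ p * ∫ ω, |f ω| ^ γ ∂μ < γ := by
  have hderiv := (hasDerivAt_id (1 : ℝ)).sub
    ((hasDerivAt_integral_abs_rpow hf one_pos hα).const_mul p)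
  have hpos := eventually_pos_nhdsGT_of_hasDerivAt hderiv
    (by simpa only [Pi.sub_apply, id, Real.rpow_one, sub_nonneg] using hp) fun heq => ?_
  · obtain ⟨γ, hγ, hγ1, hγα⟩ := (hpos.and (Ioo_mem_nhdsGT (lt_min one_lt_two hα))).exists
    exact ⟨γ, hγ1, (hγα.trans_le (min_le_left _ _)).le, (hγα.trans_le (min_le_right _ _)).le,
      sub_pos.1 hγ⟩
  · simp only [Pi.sub_apply, id, Real.rpow_one, sub_eq_zero, Real.log_abs] at heq hlog ⊢
    have hp0 : 0 < p :=
      pos_of_mul_pos_left (heq ▸ one_pos) (integral_nonneg fun ω => abs_nonneg (f ω))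
    rw [sub_pos]
    calc p * ∫ ω, |f ω| * Real.log (f ω) ∂μ < p * ∫ ω, |f ω| ∂μ := by
          gcongr
          exact hlog heq.symm
      _ = 1 := heq.symm

end Exponent

section CondExpIndep

variable {Ω : Type*} {m₁ m₂ m0 : MeasurableSpace Ω} {μ : Measure Ω} {g Y : Ω → ℝ}

theorem integrable_mul_of_indep (hindep : Indep m₁ m₂ μ) (hg : StronglyMeasurable[m₁] g)
    (hY : StronglyMeasurable[m₂] Y) (hgi : Integrable g μ) (hYi : Integrable Y μ) :
    Integrable (fun ω => g ω * Y ω) μ := by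
  have hgY : IndepFun g Y μ :=
    (IndepFun_iff_Indep g Y μ).2 (indep_of_indep_of_le_left (indep_of_indep_of_le_right hindep
      hY.measurable.comap_le) hg.measurable.comap_le)
  exact hgY.integrable_mul hgi hYi

theorem condExp_mul_of_indep [IsFiniteMeasure μ] (hm₁ : m₁ ≤ m0) (hm₂ : m₂ ≤ m0)
    (hindep : Indep m₁ m₂ μ) (hg : StronglyMeasurable[m₁] g) (hY : StronglyMeasurable[m₂] Y)
    (hgi : Integrable g μ) (hYi : Integrable Y μ) :
    μ[fun ω => g ω * Y ω|m₂] =ᵐ[μ] fun ω => (∫ ω', g ω' ∂μ) * Y ω := by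
  filter_upwards [condExp_mul_of_stronglyMeasurable_right hY
      (integrable_mul_of_indep hindep hg hY hgi hYi) hgi,
    condExp_indep_eq hm₁ hm₂ hg hindep] with ω hmul hmean
  exact hmul.trans (congrArg (· * Y ω) hmean)

theorem condExp_add_sum_mul_of_indep [IsFiniteMeasure μ] (hm₁ : m₁ ≤ m0) (hm₂ : m₂ ≤ m0)
    (hindep : Indep m₁ m₂ μ) {ι : Type*} (s : Finset ι) {F : Ω → ℝ} {g Y : ι → Ω → ℝ}
    (hF : StronglyMeasurable[m₁] F) (hFi : Integrable F μ)
    (hg : ∀ k ∈ s, StronglyMeasurable[m₁] (g k)) (hgi : ∀ k ∈ s, Integrable (g k) μ)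
    (hY : ∀ k ∈ s, StronglyMeasurable[m₂] (Y k)) (hYi : ∀ k ∈ s, Integrable (Y k) μ) :
    μ[fun ω => F ω + ∑ k ∈ s, g k ω * Y k ω|m₂]
      =ᵐ[μ] fun ω => ∫ ω', F ω' ∂μ + ∑ k ∈ s, (∫ ω', g k ω' ∂μ) * Y k ω := by
  have hint : ∀ k ∈ s, Integrable (fun ω => g k ω * Y k ω) μ := fun k hk =>
    integrable_mul_of_indep hindep (hg k hk) (hY k hk) (hgi k hk) (hYi k hk)
  have hsum : (fun ω => F ω + ∑ k ∈ s, g k ω * Y k ω)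
      = F + ∑ k ∈ s, fun ω => g k ω * Y k ω := by
    ext ω
    rw [Pi.add_apply, Finset.sum_apply]
  have hcond : ∀ᵐ ω ∂μ, ∀ k ∈ s,
      (μ[fun ω => g k ω * Y k ω|m₂]) ω = (∫ ω', g k ω' ∂μ) * Y k ω :=
    (Finset.eventually_all s).2 fun k hk =>
      condExp_mul_of_indep hm₁ hm₂ hindep (hg k hk) (hY k hk) (hgi k hk) (hYi k hk)
  filter_upwards [condExp_add hFi (integrable_finsetSum' s hint) m₂,
    condExp_indep_eq hm₁ hm₂ hF hindep, condExp_finsetSum hint m₂, hcond]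
    with ω hadd hmean hfinset hmul
  rw [hsum, hadd, Pi.add_apply, hmean, hfinset, Finset.sum_apply, Finset.sum_congr rfl hmul]

end CondExpIndep

section EchoRecursion

variable {Ω : Type*} (X ε ξ : ℕ → Ω → ℝ) (U : ℕ → Ω → ℕ)

theorem echoStep_one : echoStep X ε ξ U 1 = X 1 := by
  ext ω
  rw [echoStep, if_pos le_rfl]

theorem echoWalk_succ_div (n : ℕ) (ω : Ω) :
    echoWalk X ε ξ U (n + 1) ω / ((n : ℝ) + 1)
      = runningMean (fun k => echoStep X ε ξ U (k + 1) ω) n := by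
  rw [runningMean, smul_eq_mul, div_eq_inv_mul, echoWalk, Finset.range_eq_Ico,
    Finset.sum_Ico_add' (fun k => echoStep X ε ξ U k ω) 0 (n + 1) 1]
  rfl

theorem sum_range_indicator_succ_mul (m u : ℕ) (v : ℕ → ℝ) :
    ∑ k ∈ Finset.range m, Set.indicator {k + 1} 1 u * v (k + 1)
      = if 1 ≤ u ∧ u < m + 1 then v u else 0 := by
  rcases u with _ | u
  · simp
  · simp [Set.indicator_apply, ite_mul]

theorem echoStep_add_two (n : ℕ) (ω : Ω) :
    echoStep X ε ξ U (n + 2) ω = (1 - ε (n + 2) ω) * X (n + 2) ω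
      + ε (n + 2) ω * ξ (n + 2) ω * ∑ k ∈ Finset.range (n + 1),
        Set.indicator {k + 1} 1 (U (n + 2) ω) * echoStep X ε ξ U (k + 1) ω := by
  rw [sum_range_indicator_succ_mul (n + 1) _ fun k => echoStep X ε ξ U k ω, echoStep,
    if_neg (by lia)]
  rfl

/-- The coefficient of `φ (echoStep X ε ξ U (k + 1) ω)` in the expansion of
`φ (echoStep X ε ξ U (n + 2) ω)`, for a multiplicative observable `φ`. -/
noncomputable def echoWeight (φ : ℝ → ℝ) (n k : ℕ) (ω : Ω) : ℝ :=
  ε (n + 2) ω * φ (ξ (n + 2) ω) * Set.indicator {k + 1} 1 (U (n + 2) ω)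

variable {X ε ξ U}

theorem comp_echoStep_add_two (φ : ℝ →*₀ ℝ) (n : ℕ) {ω : Ω}
    (hε : ε (n + 2) ω = 0 ∨ ε (n + 2) ω = 1) :
    φ (echoStep X ε ξ U (n + 2) ω) = (1 - ε (n + 2) ω) * φ (X (n + 2) ω)
      + ∑ k ∈ Finset.range (n + 1), echoWeight ε ξ U φ n k ω * φ (echoStep X ε ξ U (k + 1) ω) := by
  simp only [echoWeight, mul_assoc (ε (n + 2) ω * φ (ξ (n + 2) ω)), ← Finset.mul_sum]
  rw [echoStep_add_two, sum_range_indicator_succ_mul (n + 1) _ fun k => echoStep X ε ξ U k ω,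
    sum_range_indicator_succ_mul (n + 1) _ fun k => φ (echoStep X ε ξ U k ω)]
  rcases hε with hε | hε <;> rw [hε]
  · simp
  · split_ifs <;> simp

end EchoRecursion

section DrivingSigma

variable {Ω : Type*} {X ε ξ : ℕ → Ω → ℝ} {U : ℕ → Ω → ℕ}

/-- The time at which a driving variable enters the walk. -/
def drivingTime :
    ({n : ℕ // 1 ≤ n} ⊕ {n : ℕ // 2 ≤ n} ⊕ {n : ℕ // 2 ≤ n} ⊕ {n : ℕ // 2 ≤ n}) → ℕ :=
  Sum.elim Subtype.val (Sum.elim Subtype.val (Sum.elim Subtype.val Subtype.val))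

/-- The σ-algebra generated by the driving variables that enter at the times in `T`. -/
abbrev drivingSigma (X ε ξ : ℕ → Ω → ℝ) (U : ℕ → Ω → ℕ) (T : Set ℕ) : MeasurableSpace Ω :=
  ⨆ i ∈ drivingTime ⁻¹' T, MeasurableSpace.comap (drivingFamily X ε ξ U i) inferInstance

theorem drivingSigma_mono {S T : Set ℕ} (hST : S ⊆ T) :
    drivingSigma X ε ξ U S ≤ drivingSigma X ε ξ U T :=
  biSup_mono fun _ hi => hST hi

variable {T : Set ℕ} {n : ℕ}

theorem measurable_drivingFamily_drivingSigma {i} (hi : drivingTime i ∈ T) :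
    Measurable[drivingSigma X ε ξ U T] (drivingFamily X ε ξ U i) :=
  measurable_iff_comap_le.2 (le_biSup (fun i => MeasurableSpace.comap (drivingFamily X ε ξ U i)
    inferInstance) hi)

theorem measurable_spin_drivingSigma (hn : 1 ≤ n) (hT : n ∈ T) :
    Measurable[drivingSigma X ε ξ U T] (X n) :=
  measurable_drivingFamily_drivingSigma (i := .inl ⟨n, hn⟩) hT

theorem measurable_bern_drivingSigma (hn : 2 ≤ n) (hT : n ∈ T) :
    Measurable[drivingSigma X ε ξ U T] (ε n) :=
  measurable_drivingFamily_drivingSigma (i := .inr (.inl ⟨n, hn⟩)) hT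

theorem measurable_echo_drivingSigma (hn : 2 ≤ n) (hT : n ∈ T) :
    Measurable[drivingSigma X ε ξ U T] (ξ n) :=
  measurable_drivingFamily_drivingSigma (i := .inr (.inr (.inr ⟨n, hn⟩))) hT

theorem measurable_unif_drivingSigma (hn : 2 ≤ n) (hT : n ∈ T) :
    Measurable[drivingSigma X ε ξ U T] (U n) := by
  have hcast : Measurable[drivingSigma X ε ξ U T] fun ω => (U n ω : ℝ) :=
    measurable_drivingFamily_drivingSigma (i := .inr (.inr (.inl ⟨n, hn⟩))) hT
  simpa only [Function.comp_def, Nat.floor_natCast] using Nat.measurable_floor.comp hcast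

theorem measurable_indicator_unif_drivingSigma (hn : 2 ≤ n) (hT : n ∈ T) (k : ℕ) :
    Measurable[drivingSigma X ε ξ U T] fun ω => Set.indicator {k} (1 : ℕ → ℝ) (U n ω) :=
  (measurable_from_top (f := Set.indicator {k} (1 : ℕ → ℝ))).comp
    (measurable_unif_drivingSigma hn hT)

theorem measurable_echoWeight_drivingSigma {φ : ℝ → ℝ} (hφ : Measurable φ) (hT : n + 2 ∈ T)
    (k : ℕ) : Measurable[drivingSigma X ε ξ U T] (echoWeight ε ξ U φ n k) :=
  ((measurable_bern_drivingSigma (by lia) hT).mul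
    (hφ.comp (measurable_echo_drivingSigma (by lia) hT))).mul
    (measurable_indicator_unif_drivingSigma (by lia) hT (k + 1))

theorem measurable_echoStep (n : ℕ) :
    Measurable[drivingSigma X ε ξ U (Set.Iic (n + 1))] (echoStep X ε ξ U (n + 1)) := by
  induction n using Nat.strong_induction_on with
  | _ n ih =>
    rcases n with _ | n
    · rw [echoStep_one]
      exact measurable_spin_drivingSigma le_rfl Set.self_mem_Iic
    · have hT : n + 2 ∈ Set.Iic (n + 2) := Set.self_mem_Iic
      have hX := measurable_spin_drivingSigma (X := X) (ε := ε) (ξ := ξ) (U := U) (by lia) hT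
      have hε := measurable_bern_drivingSigma (X := X) (ε := ε) (ξ := ξ) (U := U) (by lia) hT
      have hξ := measurable_echo_drivingSigma (X := X) (ε := ε) (ξ := ξ) (U := U) (by lia) hT
      rw [funext (echoStep_add_two X ε ξ U n)]
      refine ((measurable_const.sub hε).mul hX).add ((hε.mul hξ).mul
        (Finset.measurable_fun_sum _ fun k hk => ?_))
      have hkn : k < n + 1 := Finset.mem_range.1 hk
      exact (measurable_indicator_unif_drivingSigma (by lia) hT (k + 1)).mul
        ((ih k hkn).mono (drivingSigma_mono (Set.Iic_subset_Iic.2 (by lia))) le_rfl)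

end DrivingSigma

namespace IsEchoInput

section Laws

variable {Ω : Type*} [m0 : MeasurableSpace Ω] {μ : Measure Ω} {p : ℝ} {νX νξ : Measure ℝ}
  {X ε ξ : ℕ → Ω → ℝ} {U : ℕ → Ω → ℕ}

theorem measurable_drivingFamily (h : IsEchoInput μ p νX νξ X ε ξ U) (i) :
    Measurable (drivingFamily X ε ξ U i) := by
  rcases i with i | i | i | i
  · exact h.measurable_spin i i.2
  · exact h.measurable_bern i i.2
  · exact (measurable_from_top (f := fun n : ℕ => (n : ℝ))).comp (h.measurable_unif i i.2)
  · exact h.measurable_echo i i.2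

theorem drivingSigma_le (h : IsEchoInput μ p νX νξ X ε ξ U) (T : Set ℕ) :
    drivingSigma X ε ξ U T ≤ m0 :=
  iSup₂_le fun i _ => (h.measurable_drivingFamily i).comap_le

theorem indep_drivingSigma (h : IsEchoInput μ p νX νξ X ε ξ U) {S T : Set ℕ}
    (hST : Disjoint S T) : Indep (drivingSigma X ε ξ U S) (drivingSigma X ε ξ U T) μ :=
  indep_iSup_of_disjoint (fun i => (h.measurable_drivingFamily i).comap_le) h.indep
    (hST.preimage drivingTime)

/-- The filtration generated by the driving variables; its index is shifted so that the first
`n + 1` increments are known at time `n`. -/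
def filtration (h : IsEchoInput μ p νX νξ X ε ξ U) : Filtration ℕ m0 where
  seq n := drivingSigma X ε ξ U (Set.Iic (n + 1))
  mono' _ _ hmn := drivingSigma_mono (Set.Iic_subset_Iic.2 (Nat.succ_le_succ hmn))
  le' _ := h.drivingSigma_le _

variable {φ : ℝ → ℝ} {n : ℕ}

theorem integrable_comp_spin (h : IsEchoInput μ p νX νξ X ε ξ U) (hφ : Integrable φ νX)
    (hn : 1 ≤ n) : Integrable (fun ω => φ (X n ω)) μ := by
  rw [← h.law_spin n hn] at hφ
  exact hφ.comp_measurable (h.measurable_spin n hn)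

theorem integrable_comp_echo (h : IsEchoInput μ p νX νξ X ε ξ U) (hφ : Integrable φ νξ)
    (hn : 2 ≤ n) : Integrable (fun ω => φ (ξ n ω)) μ := by
  rw [← h.law_echo n hn] at hφ
  exact hφ.comp_measurable (h.measurable_echo n hn)

theorem integral_comp_spin (h : IsEchoInput μ p νX νξ X ε ξ U) (hφ : Measurable φ)
    (hn : 1 ≤ n) : ∫ ω, φ (X n ω) ∂μ = ∫ x, φ x ∂νX := by
  rw [← h.law_spin n hn, integral_map (h.measurable_spin n hn).aemeasurable
    hφ.aestronglyMeasurable]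

theorem integral_comp_echo (h : IsEchoInput μ p νX νξ X ε ξ U) (hφ : Measurable φ)
    (hn : 2 ≤ n) : ∫ ω, φ (ξ n ω) ∂μ = ∫ x, φ x ∂νξ := by
  rw [← h.law_echo n hn, integral_map (h.measurable_echo n hn).aemeasurable
    hφ.aestronglyMeasurable]

theorem indepFun_bern_spin (h : IsEchoInput μ p νX νξ X ε ξ U) (hn : 2 ≤ n) :
    IndepFun (ε n) (X n) μ :=
  h.indep.indepFun (i := .inr (.inl ⟨n, hn⟩)) (j := .inl ⟨n, by lia⟩) (by simp)

theorem indepFun_bern_echo (h : IsEchoInput μ p νX νξ X ε ξ U) (hn : 2 ≤ n) :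
    IndepFun (ε n) (ξ n) μ :=
  h.indep.indepFun (i := .inr (.inl ⟨n, hn⟩)) (j := .inr (.inr (.inr ⟨n, hn⟩))) (by simp)

theorem indepFun_bern_echo_unif (h : IsEchoInput μ p νX νξ X ε ξ U) (hn : 2 ≤ n) :
    IndepFun (fun ω => (ε n ω, ξ n ω)) (U n) μ := by
  have hcast : IndepFun (fun ω => (ε n ω, ξ n ω)) (fun ω => (U n ω : ℝ)) μ :=
    h.indep.indepFun_prodMk h.measurable_drivingFamily (.inr (.inl ⟨n, hn⟩))
      (.inr (.inr (.inr ⟨n, hn⟩))) (.inr (.inr (.inl ⟨n, hn⟩))) (by simp) (by simp)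
  simpa only [Function.comp_def, Nat.floor_natCast, id] using
    hcast.comp measurable_id Nat.measurable_floor

theorem integral_indicator_unif (h : IsEchoInput μ p νX νξ X ε ξ U) {k : ℕ} (hk : k < n + 1) :
    ∫ ω, Set.indicator {k + 1} (1 : ℕ → ℝ) (U (n + 2) ω) ∂μ = ((n : ℝ) + 1)⁻¹ := by
  have hU : MeasurableSet (U (n + 2) ⁻¹' {k + 1}) :=
    h.measurable_unif (n + 2) (by lia) (measurableSet_singleton (k + 1))
  calc ∫ ω, Set.indicator {k + 1} (1 : ℕ → ℝ) (U (n + 2) ω) ∂μ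
      = ∫ ω, Set.indicator (U (n + 2) ⁻¹' {k + 1}) 1 ω ∂μ := rfl
    _ = μ.real {ω | U (n + 2) ω = k + 1} := integral_indicator_one hU
    _ = ((n : ℝ) + 1)⁻¹ := by
        rw [measureReal_def, h.law_unif (n + 2) (by lia) (k + 1) (by lia) (by lia)]
        rw [ENNReal.toReal_inv, ENNReal.toReal_natCast, Nat.add_sub_cancel (n + 1) 1, Nat.cast_succ]

theorem indepFun_one_sub_bern_spin (h : IsEchoInput μ p νX νξ X ε ξ U) (hφ : Measurable φ)
    (hn : 2 ≤ n) : IndepFun (fun ω => 1 - ε n ω) (fun ω => φ (X n ω)) μ :=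
  (h.indepFun_bern_spin hn).comp (measurable_const.sub measurable_id) hφ

theorem indepFun_bern_mul_echo_unif (h : IsEchoInput μ p νX νξ X ε ξ U) (hφ : Measurable φ)
    (hn : 2 ≤ n) (k : ℕ) :
    IndepFun (fun ω => ε n ω * φ (ξ n ω)) (fun ω => Set.indicator {k} (1 : ℕ → ℝ) (U n ω)) μ :=
  (h.indepFun_bern_echo_unif hn).comp (φ := fun z : ℝ × ℝ => z.1 * φ z.2)
    (measurable_fst.mul (hφ.comp measurable_snd))
    (measurable_from_top (f := Set.indicator {k} (1 : ℕ → ℝ)))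

theorem stronglyMeasurable_comp_echoStep (h : IsEchoInput μ p νX νξ X ε ξ U) (hφ : Measurable φ)
    {k : ℕ} (hkn : k ≤ n) :
    StronglyMeasurable[h.filtration n] fun ω => φ (echoStep X ε ξ U (k + 1) ω) :=
  (hφ.comp ((measurable_echoStep k).mono (h.filtration.mono hkn) le_rfl)).stronglyMeasurable

theorem indep_fresh_filtration (h : IsEchoInput μ p νX νξ X ε ξ U) (n : ℕ) :
    Indep (drivingSigma X ε ξ U {n + 2}) (h.filtration n) μ :=
  h.indep_drivingSigma (by simp)

variable [IsProbabilityMeasure μ]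

theorem mem_Icc_param (h : IsEchoInput μ p νX νξ X ε ξ U) : p ∈ Set.Icc 0 1 := by
  have h0 := (h.law_bern_zero 2 le_rfl).symm.trans_le prob_le_one
  have h1 := (h.law_bern_one 2 le_rfl).symm.trans_le prob_le_one
  rw [ENNReal.ofReal_le_one] at h0 h1
  exact ⟨by linarith, h1⟩

theorem ae_bern (h : IsEchoInput μ p νX νξ X ε ξ U) (hn : 2 ≤ n) :
    ∀ᵐ ω ∂μ, ε n ω = 0 ∨ ε n ω = 1 := by
  have hmeas : ∀ b : ℝ, MeasurableSet (ε n ⁻¹' {b}) := fun b =>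
    h.measurable_bern n hn (measurableSet_singleton b)
  have hdisj : Disjoint (ε n ⁻¹' {0}) (ε n ⁻¹' {1}) :=
    Disjoint.preimage _ (Set.disjoint_singleton.2 zero_ne_one)
  have hunion : μ (ε n ⁻¹' {0} ∪ ε n ⁻¹' {1}) = 1 := by
    rw [measure_union hdisj (hmeas 1)]
    refine (congrArg₂ (· + ·) (h.law_bern_zero n hn) (h.law_bern_one n hn)).trans ?_
    rw [← ENNReal.ofReal_add (sub_nonneg.2 h.mem_Icc_param.2) h.mem_Icc_param.1, sub_add_cancel,
      ENNReal.ofReal_one]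
  exact (prob_compl_eq_zero_iff ((hmeas 0).union (hmeas 1))).2 hunion

theorem integrable_bern (h : IsEchoInput μ p νX νξ X ε ξ U) (hn : 2 ≤ n) :
    Integrable (ε n) μ := by
  refine Integrable.of_bound (h.measurable_bern n hn).aestronglyMeasurable 1 ?_
  filter_upwards [h.ae_bern hn] with ω hω
  rcases hω with hω | hω <;> simp [hω]

theorem integral_bern (h : IsEchoInput μ p νX νξ X ε ξ U) (hn : 2 ≤ n) : ∫ ω, ε n ω ∂μ = p := by
  have hone : MeasurableSet {ω | ε n ω = 1} :=
    h.measurable_bern n hn (measurableSet_singleton 1)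
  have hind : ε n =ᵐ[μ] {ω | ε n ω = 1}.indicator 1 := by
    filter_upwards [h.ae_bern hn] with ω hω
    rcases hω with hω | hω <;> simp [Set.indicator, hω]
  rw [integral_congr_ae hind, integral_indicator_one hone, measureReal_def, h.law_bern_one n hn,
    ENNReal.toReal_ofReal h.mem_Icc_param.1]

theorem integrable_indicator_unif (h : IsEchoInput μ p νX νξ X ε ξ U) (hn : 2 ≤ n) (k : ℕ) :
    Integrable (fun ω => Set.indicator {k} (1 : ℕ → ℝ) (U n ω)) μ :=
  (integrable_const (1 : ℝ)).indicator (h.measurable_unif n hn (measurableSet_singleton k))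

theorem integrable_bern_mul_echo (h : IsEchoInput μ p νX νξ X ε ξ U) (hφ : Measurable φ)
    (hφi : Integrable φ νξ) (hn : 2 ≤ n) : Integrable (fun ω => ε n ω * φ (ξ n ω)) μ :=
  ((h.indepFun_bern_echo hn).comp measurable_id hφ).integrable_mul (h.integrable_bern hn)
    (h.integrable_comp_echo hφi hn)

theorem integral_bern_mul_echo (h : IsEchoInput μ p νX νξ X ε ξ U) (hφ : Measurable φ)
    (hn : 2 ≤ n) : ∫ ω, ε n ω * φ (ξ n ω) ∂μ = p * ∫ x, φ x ∂νξ := by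
  rw [← h.integral_bern hn, ← h.integral_comp_echo hφ hn]
  exact ((h.indepFun_bern_echo hn).comp measurable_id hφ).integral_fun_mul_eq_mul_integral
    (h.measurable_bern n hn).aestronglyMeasurable
    (hφ.comp (h.measurable_echo n hn)).aestronglyMeasurable

end Laws

section OneStep

variable {Ω : Type*} [m0 : MeasurableSpace Ω] {μ : Measure Ω} [IsProbabilityMeasure μ] {p : ℝ}
  {νX νξ : Measure ℝ} {X ε ξ : ℕ → Ω → ℝ} {U : ℕ → Ω → ℕ} {φ : ℝ → ℝ} {n k : ℕ}

theorem integrable_freshTerm (h : IsEchoInput μ p νX νξ X ε ξ U) (hφ : Measurable φ)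
    (hφi : Integrable φ νX) (hn : 2 ≤ n) : Integrable (fun ω => (1 - ε n ω) * φ (X n ω)) μ :=
  (h.indepFun_one_sub_bern_spin hφ hn).integrable_mul
    ((integrable_const 1).sub (h.integrable_bern hn)) (h.integrable_comp_spin hφi (by lia))

theorem integral_freshTerm (h : IsEchoInput μ p νX νξ X ε ξ U) (hφ : Measurable φ)
    (hn : 2 ≤ n) : ∫ ω, (1 - ε n ω) * φ (X n ω) ∂μ = (1 - p) * ∫ x, φ x ∂νX := by
  rw [(h.indepFun_one_sub_bern_spin hφ hn).integral_fun_mul_eq_mul_integral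
      (measurable_const.sub (h.measurable_bern n hn)).aestronglyMeasurable
      (hφ.comp (h.measurable_spin n (by lia))).aestronglyMeasurable,
    h.integral_comp_spin hφ (by lia), integral_sub (integrable_const 1) (h.integrable_bern hn),
    h.integral_bern hn, integral_const, probReal_univ, one_smul]

theorem integrable_echoWeight (h : IsEchoInput μ p νX νξ X ε ξ U) (hφ : Measurable φ)
    (hφi : Integrable φ νξ) : Integrable (echoWeight ε ξ U φ n k) μ :=
  (h.indepFun_bern_mul_echo_unif hφ (by lia) (k + 1)).integrable_mul
    (h.integrable_bern_mul_echo hφ hφi (by lia)) (h.integrable_indicator_unif (by lia) (k + 1))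

theorem integral_echoWeight (h : IsEchoInput μ p νX νξ X ε ξ U) (hφ : Measurable φ)
    (hφi : Integrable φ νξ) (hk : k < n + 1) :
    ∫ ω, echoWeight ε ξ U φ n k ω ∂μ = p * (∫ x, φ x ∂νξ) * ((n : ℝ) + 1)⁻¹ := by
  rw [← h.integral_bern_mul_echo hφ (n := n + 2) (by lia), ← h.integral_indicator_unif hk]
  exact (h.indepFun_bern_mul_echo_unif hφ (by lia) (k + 1)).integral_fun_mul_eq_mul_integral
    (h.integrable_bern_mul_echo hφ hφi (by lia)).aestronglyMeasurable
    (h.integrable_indicator_unif (by lia) (k + 1)).aestronglyMeasurable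

theorem integrable_echoWeight_mul (h : IsEchoInput μ p νX νξ X ε ξ U) (hφ : Measurable φ)
    (hφξ : Integrable φ νξ) (hkn : k ≤ n)
    (hk : Integrable (fun ω => φ (echoStep X ε ξ U (k + 1) ω)) μ) :
    Integrable (fun ω => echoWeight ε ξ U φ n k ω * φ (echoStep X ε ξ U (k + 1) ω)) μ :=
  have hweight : Measurable[drivingSigma X ε ξ U {n + 2}] (echoWeight ε ξ U φ n k) :=
    measurable_echoWeight_drivingSigma hφ (Set.mem_singleton _) k
  integrable_mul_of_indep (h.indep_fresh_filtration n) hweight.stronglyMeasurable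
    (h.stronglyMeasurable_comp_echoStep hφ hkn) (h.integrable_echoWeight hφ hφξ) hk

variable {φ : ℝ →*₀ ℝ}

theorem integrable_comp_echoStep (h : IsEchoInput μ p νX νξ X ε ξ U) (hφ : Measurable φ)
    (hφX : Integrable φ νX) (hφξ : Integrable φ νξ) (n : ℕ) :
    Integrable (fun ω => φ (echoStep X ε ξ U (n + 1) ω)) μ := by
  induction n using Nat.strong_induction_on with
  | _ n ih =>
    rcases n with _ | n
    · simp only [zero_add, echoStep_one]
      exact h.integrable_comp_spin hφX le_rfl
    · have hfresh : Integrable (fun ω => (1 - ε (n + 2) ω) * φ (X (n + 2) ω)) μ :=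
        h.integrable_freshTerm hφ hφX (Nat.le_add_left 2 n)
      have hecho : Integrable (fun ω => ∑ k ∈ Finset.range (n + 1),
          echoWeight ε ξ U φ n k ω * φ (echoStep X ε ξ U (k + 1) ω)) μ :=
        integrable_finsetSum _ fun k hk => h.integrable_echoWeight_mul hφ hφξ
          (Finset.mem_range_succ_iff.1 hk) (ih k (Finset.mem_range.1 hk))
      refine (hfresh.add hecho).congr ?_
      filter_upwards [h.ae_bern (Nat.le_add_left 2 n)] with ω hω
      exact (comp_echoStep_add_two φ n hω).symm

theorem condExp_comp_echoStep (h : IsEchoInput μ p νX νξ X ε ξ U) (hφ : Measurable φ)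
    (hφX : Integrable φ νX) (hφξ : Integrable φ νξ) (n : ℕ) :
    μ[fun ω => φ (echoStep X ε ξ U (n + 2) ω)|h.filtration n] =ᵐ[μ] fun ω =>
      (1 - p) * ∫ x, φ x ∂νX + p * (∫ x, φ x ∂νξ) *
        runningMean (fun k => φ (echoStep X ε ξ U (k + 1) ω)) n := by
  have hn : 2 ≤ n + 2 := Nat.le_add_left 2 n
  have hT : n + 2 ∈ ({n + 2} : Set ℕ) := Set.mem_singleton _
  have hfresh : Measurable[drivingSigma X ε ξ U {n + 2}]
      fun ω => (1 - ε (n + 2) ω) * φ (X (n + 2) ω) :=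
    (measurable_const.sub (measurable_bern_drivingSigma hn hT)).mul
      (hφ.comp (measurable_spin_drivingSigma (by lia) hT))
  have hweight : ∀ k, Measurable[drivingSigma X ε ξ U {n + 2}] (echoWeight ε ξ U φ n k) :=
    measurable_echoWeight_drivingSigma hφ hT
  have hexpand : (fun ω => φ (echoStep X ε ξ U (n + 2) ω)) =ᵐ[μ]
      fun ω => (1 - ε (n + 2) ω) * φ (X (n + 2) ω) + ∑ k ∈ Finset.range (n + 1),
        echoWeight ε ξ U φ n k ω * φ (echoStep X ε ξ U (k + 1) ω) :=
    (h.ae_bern hn).mono fun ω => comp_echoStep_add_two φ n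
  filter_upwards [condExp_congr_ae (m := h.filtration n) hexpand,
    condExp_add_sum_mul_of_indep (h.drivingSigma_le {n + 2}) (h.filtration.le n)
      (h.indep_fresh_filtration n) (Finset.range (n + 1)) hfresh.stronglyMeasurable
      (h.integrable_freshTerm hφ hφX hn) (fun k _ => (hweight k).stronglyMeasurable)
      (fun k _ => h.integrable_echoWeight hφ hφξ)
      (fun k hk => h.stronglyMeasurable_comp_echoStep hφ (Finset.mem_range_succ_iff.1 hk))
      fun k _ => h.integrable_comp_echoStep hφ hφX hφξ k] with ω hcongr hcond
  rw [hcongr, hcond, h.integral_freshTerm hφ hn, Finset.sum_congr rfl fun k hk =>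
      congrArg (· * _) (h.integral_echoWeight hφ hφξ (Finset.mem_range.1 hk)),
    ← Finset.mul_sum, mul_assoc, runningMean, smul_eq_mul]

end OneStep

end IsEchoInput

/-- `x ↦ |x| ^ γ` as a multiplicative map; multiplicativity is what carries the echo recursion
over to the absolute moments. -/
noncomputable def absRpowHom {γ : ℝ} (hγ : 0 < γ) : ℝ →*₀ ℝ where
  toFun x := |x| ^ γ
  map_zero' := by rw [abs_zero, Real.zero_rpow hγ.ne']
  map_one' := by rw [abs_one, Real.one_rpow]
  map_mul' x y := by rw [abs_mul, Real.mul_rpow (abs_nonneg x) (abs_nonneg y)]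

theorem measurable_absRpowHom {γ : ℝ} (hγ : 0 < γ) : Measurable (absRpowHom hγ) :=
  measurable_id.abs.pow_const γ

namespace IsEchoInput

section Moments

variable {Ω : Type*} [m0 : MeasurableSpace Ω] {μ : Measure Ω} [IsProbabilityMeasure μ] {p γ : ℝ}
  {νX νξ : Measure ℝ} {X ε ξ : ℕ → Ω → ℝ} {U : ℕ → Ω → ℕ}

theorem hasAffineDrift (h : IsEchoInput μ p νX νξ X ε ξ U) (hX : Integrable (fun x => x) νX)
    (hξ : Integrable (fun x => x) νξ) :
    HasAffineDrift μ h.filtration (fun n => echoStep X ε ξ U (n + 1))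
      ((1 - p) * ∫ x, x ∂νX) (p * ∫ x, x ∂νξ) where
  stronglyAdapted _ := h.stronglyMeasurable_comp_echoStep measurable_id le_rfl
  condExp_eq := h.condExp_comp_echoStep (φ := MonoidWithZeroHom.id ℝ) measurable_id hX hξ

theorem memLp_echoStep (h : IsEchoInput μ p νX νξ X ε ξ U) (hγ : 0 < γ)
    (hX : MemLp (fun x : ℝ => x) (ENNReal.ofReal γ) νX)
    (hξ : MemLp (fun x : ℝ => x) (ENNReal.ofReal γ) νξ) (n : ℕ) :
    MemLp (echoStep X ε ξ U (n + 1)) (ENNReal.ofReal γ) μ :=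
  memLp_of_integrable_abs_rpow hγ
    ((measurable_echoStep n).mono (h.drivingSigma_le _) le_rfl).aestronglyMeasurable
    (h.integrable_comp_echoStep (measurable_absRpowHom hγ) (integrable_abs_rpow_of_memLp hγ hX)
      (integrable_abs_rpow_of_memLp hγ hξ) n)

theorem integral_abs_echoStep_rpow (h : IsEchoInput μ p νX νξ X ε ξ U) (hγ : 0 < γ)
    (hX : MemLp (fun x : ℝ => x) (ENNReal.ofReal γ) νX)
    (hξ : MemLp (fun x : ℝ => x) (ENNReal.ofReal γ) νξ) (n : ℕ) :
    ∫ ω, |echoStep X ε ξ U (n + 2) ω| ^ γ ∂μ = (1 - p) * ∫ x, |x| ^ γ ∂νX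
      + p * (∫ x, |x| ^ γ ∂νξ) *
        runningMean (fun k => ∫ ω, |echoStep X ε ξ U (k + 1) ω| ^ γ ∂μ) n := by
  have hint : ∀ k, Integrable (fun ω => |echoStep X ε ξ U (k + 1) ω| ^ γ) μ := fun k =>
    integrable_abs_rpow_of_memLp hγ (h.memLp_echoStep hγ hX hξ k)
  have hcond := h.condExp_comp_echoStep (measurable_absRpowHom hγ)
    (integrable_abs_rpow_of_memLp hγ hX) (integrable_abs_rpow_of_memLp hγ hξ) n
  have hmean : Integrable (fun ω => runningMean (fun k => |echoStep X ε ξ U (k + 1) ω| ^ γ) n) μ :=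
    (integrable_finsetSum _ fun k _ => hint k).smul ((n : ℝ) + 1)⁻¹
  calc ∫ ω, |echoStep X ε ξ U (n + 2) ω| ^ γ ∂μ
      = ∫ ω, ((1 - p) * ∫ x, |x| ^ γ ∂νX + p * (∫ x, |x| ^ γ ∂νξ) *
          runningMean (fun k => |echoStep X ε ξ U (k + 1) ω| ^ γ) n) ∂μ :=
        (integral_condExp (h.filtration.le n)).symm.trans (integral_congr_ae hcond)
    _ = _ := by
        rw [integral_add (integrable_const _) (hmean.const_mul _), integral_const, probReal_univ,
          one_smul, integral_const_mul]
        simp only [runningMean]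
        rw [integral_smul, integral_finsetSum _ fun k _ => hint k]

theorem summable_integral_abs_echoStep_rpow (h : IsEchoInput μ p νX νξ X ε ξ U) (hγ : 1 < γ)
    (hX : MemLp (fun x : ℝ => x) (ENNReal.ofReal γ) νX)
    (hξ : MemLp (fun x : ℝ => x) (ENNReal.ofReal γ) νξ) (hpγ : p * ∫ x, |x| ^ γ ∂νξ < γ) :
    Summable fun n : ℕ => ((n : ℝ) + 2) ^ (-γ) * ∫ ω, |echoStep X ε ξ U (n + 2) ω| ^ γ ∂μ := by
  have hmoment : ∀ ν : Measure ℝ, 0 ≤ ∫ x, |x| ^ γ ∂ν := fun ν =>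
    integral_nonneg fun x => by positivity
  exact summable_rpow_neg_mul_of_le_runningMean hγ
    (u := fun n => ∫ ω, |echoStep X ε ξ U (n + 1) ω| ^ γ ∂μ)
    (fun n => integral_nonneg fun ω => by positivity)
    (mul_nonneg (sub_nonneg.2 h.mem_Icc_param.2) (hmoment νX))
    (mul_nonneg h.mem_Icc_param.1 (hmoment νξ)) hpγ
    fun n => (h.integral_abs_echoStep_rpow (one_pos.trans hγ) hX hξ n).le

end Moments

section Limits

variable {Ω : Type*} [MeasurableSpace Ω] {μ : Measure Ω} [IsProbabilityMeasure μ] {p γ : ℝ}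
  {νX νξ : Measure ℝ} [IsFiniteMeasure νX] [IsFiniteMeasure νξ] {X ε ξ : ℕ → Ω → ℝ}
  {U : ℕ → Ω → ℕ}

theorem tendstoASAndLp_echoWalk_div (h : IsEchoInput μ p νX νξ X ε ξ U) (hγ1 : 1 < γ)
    (hγ2 : γ ≤ 2) (hX : MemLp (fun x : ℝ => x) (ENNReal.ofReal γ) νX)
    (hξ : MemLp (fun x : ℝ => x) (ENNReal.ofReal γ) νξ) (hpγ : p * ∫ x, |x| ^ γ ∂νξ < γ)
    (hq : p * ∫ x, x ∂νξ < 1) :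
    TendstoASAndLp μ γ (fun n ω => echoWalk X ε ξ U n ω / (n : ℝ))
      ((1 - p) * (∫ x, x ∂νX) / (1 - p * ∫ x, x ∂νξ)) := by
  have hone : 1 ≤ ENNReal.ofReal γ := ENNReal.one_le_ofReal.2 hγ1.le
  have : Fact (1 ≤ ENNReal.ofReal γ) := ⟨hone⟩
  have hdrift := h.hasAffineDrift (hX.integrable hone) (hξ.integrable hone)
  have hlim := hdrift.tendstoASAndLp_runningMean hq hγ2
    (h.memLp_echoStep (one_pos.trans hγ1) hX hξ)
    (h.summable_integral_abs_echoStep_rpow hγ1 hX hξ hpγ)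
  rw [div_eq_inv_mul]
  refine tendstoASAndLp_of_succ (by simp [echoWalk]) ?_
  simpa only [Nat.cast_succ, echoWalk_succ_div] using hlim

theorem tendstoASAndLp_echoWalk_div_mul_log (h : IsEchoInput μ p νX νξ X ε ξ U) (hγ1 : 1 < γ)
    (hγ2 : γ ≤ 2) (hX : MemLp (fun x : ℝ => x) (ENNReal.ofReal γ) νX)
    (hξ : MemLp (fun x : ℝ => x) (ENNReal.ofReal γ) νξ) (hpγ : p * ∫ x, |x| ^ γ ∂νξ < γ)
    (hq : p * ∫ x, x ∂νξ = 1) :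
    TendstoASAndLp μ γ (fun n ω => echoWalk X ε ξ U n ω / ((n : ℝ) * Real.log n))
      ((1 - p) * ∫ x, x ∂νX) := by
  have hone : 1 ≤ ENNReal.ofReal γ := ENNReal.one_le_ofReal.2 hγ1.le
  have : Fact (1 ≤ ENNReal.ofReal γ) := ⟨hone⟩
  have hdrift := h.hasAffineDrift (hX.integrable hone) (hξ.integrable hone)
  rw [hq] at hdrift
  have hlim := hdrift.tendstoASAndLp_runningMean_div_log hγ2
    (h.memLp_echoStep (one_pos.trans hγ1) hX hξ)
    (h.summable_integral_abs_echoStep_rpow hγ1 hX hξ hpγ)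
  refine tendstoASAndLp_of_succ (by simp [echoWalk]) ?_
  simpa only [Nat.cast_succ, div_mul_eq_div_div, echoWalk_succ_div, div_eq_inv_mul _ (Real.log _)]
    using hlim

end Limits

end IsEchoInput

theorem theorem2_general (p : ℝ) (νX νξ : Measure ℝ) [IsProbabilityMeasure νX]
    [IsProbabilityMeasure νξ]
    (hmom : ∃ α : ℝ, 1 < α ∧ MemLp (fun x : ℝ => x) (ENNReal.ofReal α) νX ∧
      MemLp (fun x : ℝ => x) (ENNReal.ofReal α) νξ)
    (hpm : p * (∫ x, |x| ∂νξ) ≤ 1) :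
    ∃ γ : ℝ, 1 < γ ∧
      ∀ {Ω : Type*} [MeasurableSpace Ω] (μ : Measure Ω) [IsProbabilityMeasure μ]
        (X ε ξ : ℕ → Ω → ℝ) (U : ℕ → Ω → ℕ), IsEchoInput μ p νX νξ X ε ξ U →
        (p * (∫ x, |x| ∂νξ) = 1 → (∫ x, |x| * Real.log |x| ∂νξ) < ∫ x, |x| ∂νξ) →
        (p * (∫ x, x ∂νξ) = 1 →
          TendstoASAndLp μ γ
            (fun n ω => echoWalk X ε ξ U n ω / ((n : ℝ) * Real.log n))
            ((1 - p) * ∫ x, x ∂νX)) ∧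
        (p * (∫ x, x ∂νξ) < 1 →
          TendstoASAndLp μ γ
            (fun n ω => echoWalk X ε ξ U n ω / (n : ℝ))
            ((1 - p) * (∫ x, x ∂νX) / (1 - p * ∫ x, x ∂νξ))) := by
  obtain ⟨α, hα, hXα, hξα⟩ := hmom
  by_cases hlog : p * (∫ x, |x| ∂νξ) = 1 → (∫ x, |x| * Real.log |x| ∂νξ) < ∫ x, |x| ∂νξ
  · obtain ⟨γ, hγ1, hγ2, hγα, hpγ⟩ := exists_exponent_mul_integral_abs_rpow_lt hα hξα hpm hlog
    have hXγ := hXα.mono_exponent (ENNReal.ofReal_le_ofReal hγα)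
    have hξγ := hξα.mono_exponent (ENNReal.ofReal_le_ofReal hγα)
    exact ⟨γ, hγ1, fun μ _ X ε ξ U h _ =>
      ⟨h.tendstoASAndLp_echoWalk_div_mul_log hγ1 hγ2 hXγ hξγ hpγ,
        h.tendstoASAndLp_echoWalk_div hγ1 hγ2 hXγ hξγ hpγ⟩⟩
  · exact ⟨2, one_lt_two, fun μ _ X ε ξ U _ h => absurd h hlog⟩

theorem theorem2 (p : ℝ) (hp0 : 0 < p) (hp1 : p ≤ 1)
    (νX νξ : Measure ℝ) [IsProbabilityMeasure νX] [IsProbabilityMeasure νξ]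
    (hX : νX {0} < 1) (hξ : νξ {0} < 1) (hξnonneg : ∀ᵐ x ∂νξ, 0 ≤ x)
    (hmom : ∃ α : ℝ, 1 < α ∧ MemLp (fun x : ℝ => x) (ENNReal.ofReal α) νX ∧
      MemLp (fun x : ℝ => x) (ENNReal.ofReal α) νξ)
    (hpm : p * (∫ x, x ∂νξ) ≤ 1) :
    ∃ γ : ℝ, 1 < γ ∧
      ∀ {Ω : Type*} [MeasurableSpace Ω] (μ : Measure Ω) [IsProbabilityMeasure μ]
        (X ε ξ : ℕ → Ω → ℝ) (U : ℕ → Ω → ℕ), IsEchoInput μ p νX νξ X ε ξ U →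
        (p * (∫ x, x ∂νξ) = 1 → (∫ x, x * Real.log x ∂νξ) < ∫ x, x ∂νξ →
          TendstoASAndLp μ γ
            (fun n ω => echoWalk X ε ξ U n ω / ((n : ℝ) * Real.log n))
            ((1 - p) * ∫ x, x ∂νX)) ∧
        (p * (∫ x, x ∂νξ) < 1 →
          TendstoASAndLp μ γ
            (fun n ω => echoWalk X ε ξ U n ω / (n : ℝ))
            ((1 - p) * (∫ x, x ∂νX) / (1 - p * ∫ x, x ∂νξ))) := by
  have habs : ∀ᵐ x ∂νξ, |x| = x := hξnonneg.mono fun _ => abs_of_nonneg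
  have hmean : ∫ x, |x| ∂νξ = ∫ x, x ∂νξ := integral_congr_ae habs
  have hlogmean : ∫ x, |x| * Real.log |x| ∂νξ = ∫ x, x * Real.log x ∂νξ :=
    integral_congr_ae (habs.mono fun x hx => congrArg (fun t => t * Real.log t) hx)
  obtain ⟨γ, hγ, h⟩ := theorem2_general p νX νξ hmom (by rwa [hmean])
  rw [hmean, hlogmean] at h
  exact ⟨γ, hγ, fun μ _ X ε ξ U hin => ⟨fun heq hlog => (h μ X ε ξ U hin fun _ => hlog).1 heq,
    fun hlt => (h μ X ε ξ U hin fun heq => absurd heq hlt.ne).2 hlt⟩⟩
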